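/- **Setting.** A model $W=(W_1,\dots,W_P)$ consists of $P\ge 1$ subpackets of $\ell\ge1$ parameters in a finite field $\mathbb F_q$; $L=P\ell$. There are $N<q$ non-colluding databases, and $B\mid P$ segments of $P/B$ consecutive subpackets. At each time $t=1,2,\dots$ every user reads $k'=Pr'$ subpackets and updates $k=Pr$ subpackets, where $r,r'\in[0,1]$ and $k,k'$ are integers. For a user, $X^{[t]}$ is the set of indices of the $k$ updated subpackets and $\Delta^{[t]}=(\Delta^{[t]}_1,\dots,\Delta^{[t]}_k)$ are the update values, in increasing order of the subpackets. $W^{[t]}$ is $W^{[t-1]}$ with the updates of all users added to the updated subpackets. The initial model, index sets and values of all users and times up to an arbitrary horizon have an arbitrary joint law. In a scheme, a coordinator initially draws a secret permutation of the subpackets known to the users, and places content at the databases; users draw fresh noise at each time. All these draws are uniform, independent of each other and of the model and updates. Afterwards each database acts only on its own content and the messages it receives. Let $S_n^{[t]}$ be the content of database $n$ after time $t$, $G_n^{[t]}$ what a user sends to it at time $t$, and $A_{1:N}^{[t]}$ all a user downloads at time $t$ (including the announcement, by one database, of the permuted indices of the subpackets to be read). A message from a finite alphabet $\mathcal A$ counts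 as $\log_q|\mathcal A|$ symbols; the reading cost $C_R$ and writing cost $C_W$ are the numbers of symbols that a user downloads, respectively uploads, at one time, divided by $L$. A scheme is *admissible with leakage* $H(Y)$, where $Y$ is a function of a user's index set $X^{[t]}$, if for all laws of model and updates, all times, users and databases $n$: * (MDS storage, correct writing) for each subpacket $s$ database $n$ stores one symbol, the sum of the $n$th symbol of an $(\ell,N)$ MDS codeword of $W_s^{[t]}$ and a noise symbol, such that $W_s^{[t]}$ and noise together are MDS coded (besides this it may store further content); * (correct reading) each upload shows the permuted indices of the updated subpackets, and whatever $k'$ permuted indices the databases select, the users recover the corresponding set $J$ of real indices, and $H(W_J^{[t-1]}\mid A_{1:N}^{[t]})=0$; * (security) $I(W^{[t]};S_n^{[t]})=0$; * (privacy of values) $I(\Delta^{[t]};S_n^{[t-1]},G_n^{[t]}\mid X^{[t]})=0$, and $I(\Delta_i^{[t]};G_n^{[t]})=0$ for every $i$ for which $\Delta_i^{[t]}$ is independent of $Y$; * (index leakage) $I(X^{[t]};G_n^{[t]})=I(X^{[t]};S_n^{[t-1]},G_n^{[t]})=H(Y)$. Let $\hat X_j$ be the number of elements of $X^{[t]}$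 in segment $j$, and let $(\tilde X_1,\dots,\tilde X_B)$ be $(\hat X_1,\dots,\hat X_B)$ irrespective of the segment index, i.e. as a multiset. **Theorem.** For all such parameters and every number of users: 1. If $\ell=\frac{N-1}{3}$, there is a scheme whose permutations map every segment to itself, admissible with leakage $H(\hat X_1,\dots,\hat X_B)$, with $$C_R=\frac{3r'\left(1+\frac{\log_qP}{N}\right)}{1-\frac1N},\qquad C_W=\frac{3r(1+\log_qP)}{1-\frac1N},$$ and in which every database stores $O\!\left(\frac{L^2}{BN^2}\right)$ symbols. 2. If $\ell=\frac{N-1}{5}$, there is a scheme whose permutations map segments to segments, admissible with leakage $H(\tilde X_1,\dots,\tilde X_B)$, with $$C_R=\frac{5r'\left(1+\frac{\log_qP}{N}\right)}{1-\frac1N},\qquad C_W=\frac{5r(1+\log_qP)}{1-\frac1N},$$ and in which every database stores at most $\max\left\{O\!\left(\frac{L^2}{BN^2}\right),O(B^2)\right\}$ symbols. The constants in $O(\cdot)$ are absolute. -/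

import Mathlib

namespace PRUW

/-! ### Entropy of random variables on a finite probability space -/

section Entropy

variable {Ω α β γ : Type*} [Fintype Ω]

open Classical in
/-- Probability that `f = a`, for the weights `p` on the sample space. -/
noncomputable def prob (p : Ω → ℝ) (f : Ω → α) (a : α) : ℝ :=
  ∑ ω, if f ω = a then p ω else 0

open Classical in
/-- Shannon entropy `H(f)` (in nats). -/
noncomputable def entropy (p : Ω → ℝ) (f : Ω → α) : ℝ :=
  ∑ a ∈ Finset.univ.image f, Real.negMulLog (prob p f a)

/-- Conditional entropy `H(f | g) = H(f, g) - H(g)`. -/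
noncomputable def condEntropy (p : Ω → ℝ) (f : Ω → α) (g : Ω → β) : ℝ :=
  entropy p (fun ω => (f ω, g ω)) - entropy p g

/-- Mutual information `I(f ; g) = H(f) - H(f | g)`. -/
noncomputable def mutualInfo (p : Ω → ℝ) (f : Ω → α) (g : Ω → β) : ℝ :=
  entropy p f - condEntropy p f g

/-- Conditional mutual information `I(f ; g | h) = H(f | h) - H(f | g, h)`. -/
noncomputable def condMutualInfo (p : Ω → ℝ) (f : Ω → α) (g : Ω → β) (h : Ω → γ) : ℝ :=
  condEntropy p f h - condEntropy p f (fun ω => (g ω, h ω))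

end Entropy

/-! ### The model, the sparse updates and the segments -/

/-- A model: `P` subpackets of `ℓ` parameters each, with values in `F`. -/
abbrev Model (F : Type) (P ℓ : ℕ) : Type := Fin P → Fin ℓ → F

/-- A set of `k` subpacket indices. -/
abbrev SparseSet (P k : ℕ) : Type := {X : Finset (Fin P) // X.card = k}

/-- A sparse update: the set of the `k` updated subpackets, and the values of the `k` updates,
listed in increasing order of the subpackets they belong to. -/
abbrev Update (F : Type) (P ℓ k : ℕ) : Type := SparseSet P k × (Fin k → Fin ℓ → F)

/-- What a sparse update adds to subpacket `s` of the model. -/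
noncomputable def increment {F : Type} [Field F] {P ℓ k : ℕ} (u : Update F P ℓ k) (s : Fin P) :
    Fin ℓ → F :=
  if hs : s ∈ u.1.1 then u.2 ((u.1.1.orderIsoOfFin u.1.2).symm ⟨s, hs⟩) else 0

/-- The initial model and the sparse updates that `M` users make at the times `1, …, T`
(entry `t` of the second component belongs to time `t + 1`). -/
abbrev Env (F : Type) (P ℓ k M T : ℕ) : Type :=
  Model F P ℓ × (Fin T → Fin M → Update F P ℓ k)

/-- The true model after the writing phase of time `t`. -/
noncomputable def Env.model {F : Type} [Field F] {P ℓ k M T : ℕ} (e : Env F P ℓ k M T) :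
    ℕ → Model F P ℓ
  | 0 => e.1
  | t + 1 => if h : t < T
      then fun s => Env.model e t s + ∑ u, increment (e.2 ⟨t, h⟩ u) s
      else Env.model e t

/-- The segment of a subpacket, when `P` subpackets are split into `B` segments of `P / B`
consecutive subpackets. Segments are numbered from `0`. -/
def segment (P B : ℕ) (s : Fin P) : ℕ := s.val / (P / B)

/-- The vector of the numbers of sparse subpackets in the segments. -/
def segmentCounts {P k : ℕ} (B : ℕ) (X : SparseSet P k) : Fin B → ℕ :=
  fun j => (X.1.filter (fun s => segment P B s = j.val)).card

/-- The numbers of sparse subpackets in the segments, irrespective of the segment index. -/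
def unorderedCounts {P k : ℕ} (B : ℕ) (X : SparseSet P k) : Multiset ℕ :=
  Finset.univ.val.map (segmentCounts B X)

/-- `G` generates a `(card κ, N)` MDS code: any `card κ` of the `N` code symbols determine
the message. -/
def IsMDS {F κ : Type} [Field F] [Fintype κ] [DecidableEq κ] {N : ℕ}
    (G : Matrix κ (Fin N) F) : Prop :=
  Fintype.card κ ≤ N ∧ ∀ c : κ ↪ Fin N, IsUnit (G.submatrix id c).det

/-! ### Schemes -/

/-- A scheme for private federated learning with `N` non-colluding databases, `M` users, uplink
sparsification to `k` and downlink sparsification to `k'` out of `P` subpackets, in which users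
and databases address subpackets through permuted indices.

All random choices (`Key`, `Noise`, `UserNoise`) are uniform. A database acts on its own
content and on the messages it receives only. -/
structure Scheme (F : Type) (N P ℓ k k' M : ℕ) where
  /-- What the coordinator draws and tells the users, but not the databases. -/
  Key : Type
  /-- Further random symbols of the coordinator, known to nobody else. -/
  Noise : Type
  /-- Random symbols a user draws afresh for each writing phase. -/
  UserNoise : Type
  /-- What database `n` stores besides one coded symbol per subpacket. -/
  Aux : Fin N → Type
  /-- Message from a user to database `n` in a writing phase. -/
  Upload : Fin N → Type
  /-- Announcement of the subpackets to be read, sent by one designated database. -/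
  Announcement : Type
  /-- Answer of database `n` to a user in a reading phase. -/
  Answer : Fin N → Type
  [fintypeKey : Fintype Key]
  [nonemptyKey : Nonempty Key]
  [fintypeNoise : Fintype Noise]
  [nonemptyNoise : Nonempty Noise]
  [fintypeUserNoise : Fintype UserNoise]
  [nonemptyUserNoise : Nonempty UserNoise]
  [fintypeAux : ∀ n, Fintype (Aux n)]
  [fintypeUpload : ∀ n, Fintype (Upload n)]
  [fintypeAnnouncement : Fintype Announcement]
  [fintypeAnswer : ∀ n, Fintype (Answer n)]
  /-- The real index of the subpacket with a given permuted index. -/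
  perm : Key → Equiv.Perm (Fin P)
  /-- Coded symbols placed at database `n` by the coordinator. -/
  initCoded : Key → Noise → Model F P ℓ → Fin N → Fin P → F
  /-- Additional content placed at database `n` by the coordinator. -/
  initAux : Key → Noise → (n : Fin N) → Aux n
  /-- What a user sends to database `n`. -/
  upload : Key → UserNoise → Update F P ℓ k → (n : Fin N) → Upload n
  /-- The permuted indices of the updated subpackets, as database `n` sees them. -/
  uploadedIndices : (n : Fin N) → Upload n → Finset (Fin P)
  /-- How database `n` updates its coded symbols, given the messages of all users. -/
  write : (n : Fin N) → (Fin P → F) → Aux n → (Fin M → Upload n) → Fin P → F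
  /-- Announcement of a list of permuted indices. -/
  announce : (Fin k' ↪ Fin P) → Announcement
  /-- Answer of database `n` when subpackets with given permuted indices are to be read. -/
  answer : (n : Fin N) → (Fin P → F) → Aux n → (Fin k' ↪ Fin P) → Answer n
  /-- The user recovers the real indices of the announced subpackets. -/
  decodeIndices : Key → Announcement → Fin k' → Fin P
  /-- The user recovers the announced subpackets from the downloads. -/
  decode : Announcement → ((n : Fin N) → Answer n) → Fin k' → Fin ℓ → F

namespace Scheme

attribute [instance] fintypeKey nonemptyKey fintypeNoise nonemptyNoise fintypeUserNoise
  nonemptyUserNoise fintypeAux fintypeUpload fintypeAnnouncement fintypeAnswer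

section Execution

variable {F : Type} [Field F] [Fintype F] {N P ℓ k k' M : ℕ} (𝒮 : Scheme F N P ℓ k k' M)

/-- Outcomes of an execution over the times `1, …, T`: the initial model and the users'
updates, the key, the noise of the coordinator, the noise of the users. -/
abbrev Outcome (T : ℕ) : Type :=
  Env F P ℓ k M T × 𝒮.Key × 𝒮.Noise × (Fin T → Fin M → 𝒮.UserNoise)

/-- The probability of an outcome: model and updates have the joint law `D`; key and noises
are uniform, independent of each other and of model and updates. -/
noncomputable def weight {T : ℕ} (D : Env F P ℓ k M T → ℝ) (ω : 𝒮.Outcome T) : ℝ :=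
  D ω.1 * (Fintype.card 𝒮.Key : ℝ)⁻¹ * (Fintype.card 𝒮.Noise : ℝ)⁻¹ *
    (Fintype.card (Fin T → Fin M → 𝒮.UserNoise) : ℝ)⁻¹

/-- The model after the writing phase of time `t`. -/
noncomputable def modelAt {T : ℕ} (t : ℕ) (ω : 𝒮.Outcome T) : Model F P ℓ := ω.1.model t

/-- The set of sparse subpackets of user `u` at time `t + 1`. -/
def sparseSetAt {T : ℕ} (t : Fin T) (u : Fin M) (ω : 𝒮.Outcome T) : SparseSet P k :=
  (ω.1.2 t u).1

/-- The values of the updates of user `u` at time `t + 1`. -/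
def valuesAt {T : ℕ} (t : Fin T) (u : Fin M) (ω : 𝒮.Outcome T) : Fin k → Fin ℓ → F :=
  (ω.1.2 t u).2

/-- What user `u` sends to database `n` at time `t + 1`. -/
def uploadAt {T : ℕ} (t : Fin T) (u : Fin M) (n : Fin N) (ω : 𝒮.Outcome T) : 𝒮.Upload n :=
  𝒮.upload ω.2.1 (ω.2.2.2 t u) (ω.1.2 t u) n

/-- The additional content of database `n`. -/
def auxOf {T : ℕ} (n : Fin N) (ω : 𝒮.Outcome T) : 𝒮.Aux n := 𝒮.initAux ω.2.1 ω.2.2.1 n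

/-- The coded symbols of database `n` after the writing phase of time `t`. -/
def codedAt {T : ℕ} (n : Fin N) (ω : 𝒮.Outcome T) : ℕ → Fin P → F
  | 0 => 𝒮.initCoded ω.2.1 ω.2.2.1 ω.1.1 n
  | t + 1 => if h : t < T
      then 𝒮.write n (codedAt n ω t) (𝒮.auxOf n ω) (fun u => 𝒮.uploadAt ⟨t, h⟩ u n ω)
      else codedAt n ω t

/-- The content of database `n` after the writing phase of time `t`. -/
def contentAt {T : ℕ} (n : Fin N) (t : ℕ) (ω : 𝒮.Outcome T) : (Fin P → F) × 𝒮.Aux n :=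
  (𝒮.codedAt n ω t, 𝒮.auxOf n ω)

/-- All that a user downloads in the reading phase of time `t + 1`, when the databases have
decided to send the subpackets with permuted indices `v`. -/
def downloadAt {T : ℕ} (t : ℕ) (v : Fin k' ↪ Fin P) (ω : 𝒮.Outcome T) :
    𝒮.Announcement × ((n : Fin N) → 𝒮.Answer n) :=
  (𝒮.announce v, fun n => 𝒮.answer n (𝒮.codedAt n ω t) (𝒮.auxOf n ω) v)

/-! ### Requirements on a scheme -/

/-- At every time each database holds, for each subpacket of the current model, one symbol
which is the sum of its symbol of an `(ℓ, N)` MDS codeword of that subpacket and of a noise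
symbol, model and noise being jointly MDS coded. In particular the writing phases update the
stored model correctly. -/
def StoresModel : Prop :=
  ∃ (m : ℕ) (G : Matrix (Fin ℓ) (Fin N) F) (H : Matrix (Fin m) (Fin N) F),
    IsMDS G ∧ IsMDS (Matrix.fromRows G H) ∧
    ∀ (T : ℕ) (ω : 𝒮.Outcome T) (t : ℕ), t ≤ T → ∀ s : Fin P, ∃ z : Fin m → F,
      ∀ n : Fin N, 𝒮.codedAt n ω t s =
        ∑ i, 𝒮.modelAt t ω s i * G i n + ∑ i, z i * H i n

/-- Each database sees the permuted indices of the subpackets a user updates. -/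
def UploadsIndices : Prop :=
  ∀ (K : 𝒮.Key) (z : 𝒮.UserNoise) (u : Update F P ℓ k) (n : Fin N),
    (𝒮.uploadedIndices n (𝒮.upload K z u n)).map (𝒮.perm K).toEmbedding = u.1.1

/-- Correctness of reading. Whatever permuted indices the databases select, users decode the
real indices and the corresponding subpackets of the current model, the latter from the
downloads alone; in terms of entropies, `H(W_J | A_{1:N}) = 0` for every law of the model and
the updates and every selection rule (which may depend on anything). -/
def ReadsCorrectly : Prop :=
  (∀ (T : ℕ) (ω : 𝒮.Outcome T) (t : ℕ), t ≤ T → ∀ (v : Fin k' ↪ Fin P) (i : Fin k'),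
    𝒮.decodeIndices ω.2.1 (𝒮.announce v) i = 𝒮.perm ω.2.1 (v i) ∧
    𝒮.decode (𝒮.downloadAt t v ω).1 (𝒮.downloadAt t v ω).2 i =
      𝒮.modelAt t ω (𝒮.perm ω.2.1 (v i))) ∧
  ∀ (T : ℕ) (D : Env F P ℓ k M T → ℝ), D ∈ stdSimplex ℝ (Env F P ℓ k M T) →
    ∀ (t : ℕ), t ≤ T → ∀ v : 𝒮.Outcome T → (Fin k' ↪ Fin P),
      condEntropy (𝒮.weight D)
        (fun ω i => 𝒮.modelAt t ω (𝒮.perm ω.2.1 (v ω i)))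
        (fun ω => 𝒮.downloadAt t (v ω) ω) = 0

/-- Security of the model: the content of a database is independent of the current model. -/
def Secure : Prop :=
  ∀ (T : ℕ) (D : Env F P ℓ k M T → ℝ), D ∈ stdSimplex ℝ (Env F P ℓ k M T) →
    ∀ (t : ℕ), t ≤ T → ∀ n : Fin N,
      mutualInfo (𝒮.weight D) (𝒮.modelAt t) (𝒮.contentAt n t) = 0

/-- Privacy of the values of the updates, when the index leakage amounts to the statistic
`stat` of the set of sparse subpackets. Given that set, the values are independent of all that
a database has and receives; and an update value that is independent of the leaked statistic
is independent of what a database receives. -/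
def PrivateValues {α : Type} (stat : SparseSet P k → α) : Prop :=
  ∀ (T : ℕ) (D : Env F P ℓ k M T → ℝ), D ∈ stdSimplex ℝ (Env F P ℓ k M T) →
    ∀ (t : Fin T) (u : Fin M) (n : Fin N),
      condMutualInfo (𝒮.weight D) (𝒮.valuesAt t u)
        (fun ω => (𝒮.contentAt n t ω, 𝒮.uploadAt t u n ω)) (𝒮.sparseSetAt t u) = 0 ∧
      ∀ i : Fin k,
        mutualInfo (𝒮.weight D) (fun ω => 𝒮.valuesAt t u ω i)
          (fun ω => stat (𝒮.sparseSetAt t u ω)) = 0 →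
        mutualInfo (𝒮.weight D) (fun ω => 𝒮.valuesAt t u ω i) (𝒮.uploadAt t u n) = 0

/-- The information that a database gets on the set of sparse subpackets of a user from what
the user sends is the entropy of the statistic `stat` of that set, also when the content of
the database before the writing phase is taken into account. -/
def IndexLeakage {α : Type} (stat : SparseSet P k → α) : Prop :=
  ∀ (T : ℕ) (D : Env F P ℓ k M T → ℝ), D ∈ stdSimplex ℝ (Env F P ℓ k M T) →
    ∀ (t : Fin T) (u : Fin M) (n : Fin N),
      mutualInfo (𝒮.weight D) (𝒮.sparseSetAt t u) (𝒮.uploadAt t u n) =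
        entropy (𝒮.weight D) (fun ω => stat (𝒮.sparseSetAt t u ω)) ∧
      mutualInfo (𝒮.weight D) (𝒮.sparseSetAt t u)
          (fun ω => (𝒮.contentAt n t ω, 𝒮.uploadAt t u n ω)) =
        entropy (𝒮.weight D) (fun ω => stat (𝒮.sparseSetAt t u ω))

/-! ### Costs, counted in symbols of `F`: a message from a finite set `A` has `log_q |A|` symbols -/

/-- The number of symbols of `F` in an element of the finite set `A`. -/
noncomputable def symbols (F A : Type) [Fintype F] [Fintype A] : ℝ :=
  Real.logb (Fintype.card F) (Fintype.card A)

/-- Reading cost: symbols a user downloads in a reading phase, divided by the model size. -/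
noncomputable def readingCost : ℝ :=
  (symbols F 𝒮.Announcement + ∑ n, symbols F (𝒮.Answer n)) / ((P : ℝ) * ℓ)

/-- Writing cost: symbols a user uploads in a writing phase, divided by the model size. -/
noncomputable def writingCost : ℝ := (∑ n, symbols F (𝒮.Upload n)) / ((P : ℝ) * ℓ)

/-- Number of symbols stored in database `n`. -/
noncomputable def storage (n : Fin N) : ℝ := symbols F ((Fin P → F) × 𝒮.Aux n)

end Execution

end Scheme

end PRUW

/-!
The scheme stores polynomials in the evaluation point `x n` of a database, and keeps the data in
their coefficients below degree `ℓ`; all noise sits in degree at least `ℓ`. Each database holds, for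
every subpacket, the value of a polynomial that carries the subpacket, and a noisy copy
`(permutation matrix) + x ^ ℓ * (noise)` of the matrix that translates permuted into real indices.
An upload consists of the permuted indices of the updated subpackets in increasing order, each with
the value of a polynomial of degree `ℓ` that carries the update, masked by fresh noise in degree
`ℓ`. Multiplying the noisy matrix by the upload, or its transpose by the storage, does not disturb
the coefficients below `ℓ`, as the matrix is exact modulo `X ^ ℓ` (`Encodes.mul`). If the entries of
the matrix have degree at most `d * ℓ`, storage has degree at most `(d + 1) * ℓ` and answers have
degree at most `(2 * d + 1) * ℓ`, so `N = (2 * d + 1) * ℓ + 1` answers determine the data by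
interpolation. Permutations within the segments need `d = 1` and `P ^ 2 / B` stored marks
(`withinSegments`). To permute the segments as well, the matrix is written entrywise as a product of
two noisy factors, of which the second has only `B ^ 2` entries; this gives `d = 2`
(`acrossSegments`).

Privacy rests on one argument. As the points `x n` are nonzero, the noise makes the stored symbols,
the stored marks and the uploaded values at a single database jointly uniform, whatever the model,
the updates and the permutation are. There remains the permuted image of the updated set, which is
uniform on the orbit of that set under the group of permutations. The orbits are the level sets of
the (ordered or unordered) segment counts (`segmentCounts_eq_iff`, `unorderedCounts_eq_iff`). Hence
an observation determines the counts, and two environments with the same counts produce each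
observation for equally many outcomes of the randomness (`RevealsOnly`,
`Addressing.revealsOnly_content_upload`). All the entropy identities follow from this
(`RevealsOnly.prob_mul_prob`). The second privacy condition moreover uses that vanishing mutual
information implies independence (`indep_of_mutualInfo_eq_zero`).
-/

namespace PRUW

open Polynomial

/-! ### Entropy identities -/

section EntropyIdentities

variable {Ω α β γ δ : Type*} [Fintype Ω]

lemma prob_congr (p : Ω → ℝ) {f : Ω → α} {g : Ω → β} {a : α} {b : β}
    (h : ∀ ω, f ω = a ↔ g ω = b) : prob p f a = prob p g b := by
  classical
  exact Finset.sum_congr rfl fun ω _ => if_congr (h ω) rfl rfl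

lemma prob_nonneg {p : Ω → ℝ} (hp : ∀ ω, 0 ≤ p ω) (f : Ω → α) (a : α) : 0 ≤ prob p f a := by
  refine Finset.sum_nonneg fun ω _ => ?_
  split_ifs
  exacts [hp ω, le_rfl]

lemma prob_pos {p : Ω → ℝ} (hp : ∀ ω, 0 ≤ p ω) (f : Ω → α) {ω : Ω} (hω : p ω ≠ 0) :
    0 < prob p f (f ω) := by
  classical
  refine lt_of_lt_of_le (lt_of_le_of_ne (hp ω) (Ne.symm hω)) ?_
  have := Finset.single_le_sum (f := fun ω' => if f ω' = f ω then p ω' else 0)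
    (fun ω' _ => by split_ifs; exacts [hp ω', le_rfl]) (Finset.mem_univ ω)
  simpa [prob] using this

lemma prob_const {p : Ω → ℝ} (hp : ∑ ω, p ω = 1) (f : Ω → α) {a : α} (h : ∀ ω, f ω = a) :
    prob p f a = 1 := by
  simp [prob, h, hp]

/-- Entropy as the expectation of the self-information, a sum over the sample space. -/
lemma entropy_eq_neg_sum (p : Ω → ℝ) (f : Ω → α) :
    entropy p f = -∑ ω, p ω * Real.log (prob p f (f ω)) := by
  classical
  rw [entropy, ← Finset.sum_fiberwise_of_maps_to (t := Finset.univ.image f) (g := f)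
    (fun ω _ => Finset.mem_image_of_mem f (Finset.mem_univ ω)), ← Finset.sum_neg_distrib]
  refine Finset.sum_congr (by congr) fun a _ => ?_
  rw [Real.negMulLog, neg_mul]
  congr 1
  have hq : prob p f a * Real.log (prob p f a) =
      ∑ ω, (if f ω = a then p ω else 0) * Real.log (prob p f a) := by
    rw [← Finset.sum_mul]
    rfl
  rw [hq, Finset.sum_filter]
  refine Finset.sum_congr rfl fun ω _ => ?_
  by_cases h : f ω = a
  · rw [if_pos h, if_pos h, h]
  · rw [if_neg h, if_neg h, zero_mul]

/-- A multiplicative identity between the probabilities of four random variables, on the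
support, yields the additive identity between their entropies. -/
lemma entropy_add_entropy_eq {p : Ω → ℝ} (hp : ∀ ω, 0 ≤ p ω) {f₁ : Ω → α} {f₂ : Ω → β}
    {f₃ : Ω → γ} {f₄ : Ω → δ}
    (h : ∀ ω, p ω ≠ 0 → prob p f₁ (f₁ ω) * prob p f₂ (f₂ ω) =
      prob p f₃ (f₃ ω) * prob p f₄ (f₄ ω)) :
    entropy p f₁ + entropy p f₂ = entropy p f₃ + entropy p f₄ := by
  simp only [entropy_eq_neg_sum, ← neg_add, ← Finset.sum_add_distrib, ← mul_add]
  congr 1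
  refine Finset.sum_congr rfl fun ω _ => ?_
  by_cases hω : p ω = 0
  · simp [hω]
  rw [← Real.log_mul (prob_pos hp f₁ hω).ne' (prob_pos hp f₂ hω).ne',
    ← Real.log_mul (prob_pos hp f₃ hω).ne' (prob_pos hp f₄ hω).ne', h ω hω]

lemma condEntropy_eq_zero_of_comp (p : Ω → ℝ) {f : Ω → α} {g : Ω → β} (φ : β → α)
    (h : ∀ ω, f ω = φ (g ω)) : condEntropy p f g = 0 := by
  rw [condEntropy, sub_eq_zero, entropy_eq_neg_sum, entropy_eq_neg_sum]
  congr 1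
  refine Finset.sum_congr rfl fun ω _ => ?_
  rw [prob_congr p (g := g) (b := g ω)]
  intro ω'
  rw [Prod.mk.injEq]
  exact ⟨And.right, fun h' => ⟨by rw [h, h, h'], h'⟩⟩

lemma entropy_unit {p : Ω → ℝ} (hp1 : ∑ ω, p ω = 1) : entropy p (fun _ => ()) = 0 := by
  rw [entropy_eq_neg_sum]
  simp [prob_const hp1 (fun _ : Ω => ()) (a := ()) fun _ => rfl]

lemma mutualInfo_eq_zero_of_indep {p : Ω → ℝ} (hp : ∀ ω, 0 ≤ p ω) (hp1 : ∑ ω, p ω = 1)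
    {f : Ω → α} {g : Ω → β}
    (h : ∀ ω, p ω ≠ 0 →
      prob p (fun ω => (f ω, g ω)) (f ω, g ω) = prob p f (f ω) * prob p g (g ω)) :
    mutualInfo p f g = 0 := by
  have h1 := entropy_add_entropy_eq hp (f₁ := fun ω => (f ω, g ω)) (f₂ := fun _ : Ω => ())
    (f₃ := f) (f₄ := g) (fun ω hω => by
      rw [prob_const hp1 (fun _ : Ω => ()) fun _ => rfl, mul_one]; exact h ω hω)
  rw [entropy_unit hp1] at h1
  rw [mutualInfo, condEntropy]
  linarith

lemma sum_prob_image (p : Ω → ℝ) (f : Ω → α) [DecidableEq α] :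
    ∑ a ∈ Finset.univ.image f, prob p f a = ∑ ω, p ω := by
  rw [← Finset.sum_fiberwise_of_maps_to (t := Finset.univ.image f) (g := f)
    (fun ω _ => Finset.mem_image_of_mem f (Finset.mem_univ ω))]
  refine Finset.sum_congr rfl fun a _ => ?_
  rw [Finset.sum_filter, prob]
  exact Finset.sum_congr rfl fun ω _ => by congr

lemma prob_eq_zero_of_notMem_range (p : Ω → ℝ) {f : Ω → α} {a : α} (h : ∀ ω, f ω ≠ a) :
    prob p f a = 0 := by
  simp [prob, h]

/-- The equality case of Gibbs' inequality: vanishing mutual information is independence. -/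
lemma indep_of_mutualInfo_eq_zero {p : Ω → ℝ} (hp : ∀ ω, 0 ≤ p ω) (hp1 : ∑ ω, p ω = 1)
    {f : Ω → α} {g : Ω → β} (h : mutualInfo p f g = 0) (a : α) (b : β) :
    prob p (fun ω => (f ω, g ω)) (a, b) = prob p f a * prob p g b := by
  classical
  set J : α → β → ℝ := fun a b => prob p (fun ω => (f ω, g ω)) (a, b) with hJ
  have hmarg : ∀ a b, J a b ≤ prob p f a ∧ J a b ≤ prob p g b := by
    intro a b
    constructor <;>
    · refine Finset.sum_le_sum fun ω _ => ?_
      by_cases h1 : f ω = a <;> by_cases h2 : g ω = b <;> simp [h1, h2, hp ω]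
  by_cases ha : ∃ ω, f ω = a
  swap
  · push Not at ha
    rw [prob_eq_zero_of_notMem_range p ha, zero_mul]
    exact prob_eq_zero_of_notMem_range p fun ω h => ha ω (Prod.mk.inj h).1
  by_cases hb : ∃ ω, g ω = b
  swap
  · push Not at hb
    rw [prob_eq_zero_of_notMem_range p hb, mul_zero]
    exact prob_eq_zero_of_notMem_range p fun ω h => hb ω (Prod.mk.inj h).2
  set A := Finset.univ.image f
  set B := Finset.univ.image g
  -- the joint law against the product of the marginals, normalized to be nonnegative
  let t : α → β → ℝ := fun a b => J a b * Real.log (J a b) - J a b * Real.log (prob p f a)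
    - J a b * Real.log (prob p g b) - J a b + prob p f a * prob p g b
  have ht : ∀ a b, 0 ≤ t a b ∧ (t a b = 0 → J a b = prob p f a * prob p g b) := by
    intro a b
    have hf := prob_nonneg hp f a
    have hg := prob_nonneg hp g b
    have hj : 0 ≤ J a b := prob_nonneg hp _ _
    rcases hj.eq_or_lt with h0 | h0
    · simp only [t, ← h0]
      simp only [zero_mul, sub_zero, zero_add]
      exact ⟨mul_nonneg hf hg, fun h => h.symm⟩
    · have hf' := h0.trans_le (hmarg a b).1
      have hg' := h0.trans_le (hmarg a b).2
      have hm := mul_pos hf' hg'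
      have e : t a b = (prob p f a * prob p g b) *
          InformationTheory.klFun (J a b / (prob p f a * prob p g b)) := by
        rw [InformationTheory.klFun_apply, Real.log_div h0.ne' hm.ne',
          Real.log_mul hf'.ne' hg'.ne']
        simp only [t]
        field_simp
        ring
      have hq : 0 ≤ J a b / (prob p f a * prob p g b) := by positivity
      rw [e]
      refine ⟨mul_nonneg hm.le (InformationTheory.klFun_nonneg hq), fun h => ?_⟩
      rw [mul_eq_zero, or_iff_right hm.ne', InformationTheory.klFun_eq_zero_iff hq,
        div_eq_one_iff_eq hm.ne'] at h
      exact h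
  have hexp : ∀ φ : α → β → ℝ,
      ∑ a ∈ A, ∑ b ∈ B, J a b * φ a b = ∑ ω, p ω * φ (f ω) (g ω) := by
    intro φ
    have : ∀ a b, J a b * φ a b = ∑ ω, if f ω = a ∧ g ω = b then p ω * φ a b else 0 := by
      intro a b
      simp only [hJ, prob, Finset.sum_mul, Prod.mk.injEq, ite_mul, zero_mul]
    simp only [this]
    rw [Finset.sum_congr rfl fun a _ => Finset.sum_comm, Finset.sum_comm]
    refine Finset.sum_congr rfl fun ω _ => ?_
    rw [Finset.sum_eq_single (f ω), Finset.sum_eq_single (g ω)]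
    · simp
    · intro b _ hb; simp [hb.symm]
    · intro h; exact absurd (Finset.mem_image_of_mem g (Finset.mem_univ ω)) h
    · intro a _ ha; simp [ha.symm]
    · intro h; exact absurd (Finset.mem_image_of_mem f (Finset.mem_univ ω)) h
  have hsum : ∑ a ∈ A, ∑ b ∈ B, t a b = 0 := by
    simp only [t, Finset.sum_add_distrib, Finset.sum_sub_distrib]
    rw [hexp fun a b => Real.log (J a b), hexp fun a _ => Real.log (prob p f a),
      hexp fun _ b => Real.log (prob p g b)]
    have h1 := hexp fun _ _ => 1
    simp only [mul_one] at h1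
    rw [h1, hp1, ← Finset.sum_mul_sum, sum_prob_image, sum_prob_image, hp1]
    rw [mutualInfo, condEntropy, entropy_eq_neg_sum, entropy_eq_neg_sum, entropy_eq_neg_sum] at h
    linarith
  rw [Finset.sum_eq_zero_iff_of_nonneg
    fun a _ => Finset.sum_nonneg fun b _ => (ht a b).1] at hsum
  have h1 := hsum a (by simpa [A] using ha)
  rw [Finset.sum_eq_zero_iff_of_nonneg fun b _ => (ht a b).1] at h1
  exact (ht a b).2 (h1 b (by simpa [B] using hb))

end EntropyIdentities

/-! ### Observations that depend on a secret through a statistic only -/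

section Leakage

variable {E R β σ γ γ' : Type*}

/-- The randomness `R` hides the secret `E` from an observer of `V`, up to the statistic `S`:
`V` determines `S`, and for secrets with the same value of `S` the observation takes each of
its values for the same number of outcomes of the randomness, as is witnessed by injections of
the randomness into itself. -/
structure RevealsOnly (V : E × R → β) (S : E → σ) : Prop where
  reads : ∀ e r e' r', V (e, r) = V (e', r') → S e = S e'
  hides : ∀ e e', S e = S e' →
    ∃ φ : R → R, Function.Injective φ ∧ ∀ r, V (e', φ r) = V (e, r)

variable {V : E × R → β} {S : E → σ}

lemma RevealsOnly.comp {β' : Type*} (H : RevealsOnly V S) (h : β → β')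
    (hr : ∀ e r e' r', h (V (e, r)) = h (V (e', r')) → S e = S e') :
    RevealsOnly (fun ω => h (V ω)) S where
  reads := hr
  hides e e' he := by
    obtain ⟨φ, hφ, h1⟩ := H.hides e e' he
    exact ⟨φ, hφ, fun r => congrArg h (h1 r)⟩

open Classical in
lemma RevealsOnly.card_eq [Fintype R] (H : RevealsOnly V S) {e e' : E} (he : S e = S e') (v : β) :
    (Finset.univ.filter fun r => V (e, r) = v).card =
      (Finset.univ.filter fun r => V (e', r) = v).card := by
  have key : ∀ {e e' : E}, S e = S e' → (Finset.univ.filter fun r => V (e, r) = v).card ≤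
      (Finset.univ.filter fun r => V (e', r) = v).card := by
    intro e e' he
    obtain ⟨φ, hφ, h1⟩ := H.hides e e' he
    exact Finset.card_le_card_of_injOn φ (by intro r hr; simpa [h1] using hr) hφ.injOn
  exact le_antisymm (key he) (key he.symm)

variable [Fintype E] [Fintype R] {D : E → ℝ} {c : ℝ} {p : E × R → ℝ}

open Classical in
lemma prob_prodMk_observation (hp : ∀ ω, p ω = D ω.1 * c) (V : E × R → β) (f : E → γ) (a : γ)
    (v : β) :
    prob p (fun ω => (f ω.1, V ω)) (a, v) =
      ∑ e, (if f e = a then D e * c else 0) *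
        (Finset.univ.filter fun r => V (e, r) = v).card := by
  rw [prob, Fintype.sum_prod_type]
  refine Finset.sum_congr rfl fun e _ => ?_
  rw [Finset.card_filter, Nat.cast_sum, Finset.mul_sum]
  refine Finset.sum_congr rfl fun r _ => ?_
  by_cases h1 : f e = a <;> by_cases h2 : V (e, r) = v <;> simp [h1, h2, hp]

/-- Given the statistic, the observation is independent of the secret; here `f` and `f'` are
arbitrary functions of the secret, and denominators are cleared. -/
lemma RevealsOnly.prob_mul_prob (H : RevealsOnly V S) (hp : ∀ ω, p ω = D ω.1 * c)
    (f : E → γ) (f' : E → γ') (a : γ) (a' : γ') (ω₀ : E × R) :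
    prob p (fun ω => (f ω.1, V ω)) (a, V ω₀) *
        prob p (fun ω => (f' ω.1, S ω.1)) (a', S ω₀.1) =
      prob p (fun ω => (f' ω.1, V ω)) (a', V ω₀) *
        prob p (fun ω => (f ω.1, S ω.1)) (a, S ω₀.1) := by
  classical
  have hz : ∀ e, S e ≠ S ω₀.1 → (Finset.univ.filter fun r => V (e, r) = V ω₀).card = 0 := by
    intro e he
    rw [Finset.card_eq_zero, Finset.filter_eq_empty_iff]
    exact fun r _ hr => he (H.reads e r ω₀.1 ω₀.2 hr)
  rw [prob_prodMk_observation hp V f, prob_prodMk_observation hp V f',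
    prob_prodMk_observation hp (fun ω => S ω.1) f, prob_prodMk_observation hp (fun ω => S ω.1) f',
    Finset.sum_mul_sum, Finset.sum_mul_sum, Finset.sum_comm]
  refine Finset.sum_congr rfl fun e' _ => Finset.sum_congr rfl fun e _ => ?_
  by_cases h1 : S e = S ω₀.1 <;> by_cases h2 : S e' = S ω₀.1
  · rw [H.card_eq (h1.trans h2.symm)]
    simp only [h1, h2]
    ring
  · simp [hz e' h2, h2]
  · simp [hz e h1, h1]
  · simp [h1, h2]

/-- The observer learns `H(S)` about every function of the secret that determines `S`. -/
lemma RevealsOnly.mutualInfo_eq (H : RevealsOnly V S) (hp : ∀ ω, p ω = D ω.1 * c)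
    (hp0 : ∀ ω, 0 ≤ p ω) (f : E → γ) (s : γ → σ) (hs : ∀ e, S e = s (f e)) :
    mutualInfo p (fun ω => f ω.1) V = entropy p (fun ω => S ω.1) := by
  have h := entropy_add_entropy_eq hp0 (f₁ := fun ω => (f ω.1, V ω)) (f₂ := fun ω => S ω.1)
    (f₃ := V) (f₄ := fun ω => f ω.1) (fun ω _ => by
      have h1 := H.prob_mul_prob hp f (fun _ => ()) (f ω.1) () ω
      have h2 : ∀ ω' : E × R, (f ω'.1, S ω'.1) = (f ω.1, S ω.1) ↔ f ω'.1 = f ω.1 := by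
        intro ω'
        simp only [Prod.mk.injEq, hs]
        exact ⟨And.left, fun h => ⟨h, by rw [h]⟩⟩
      rwa [prob_congr p h2, prob_congr p (f := fun ω => ((), S ω.1)) (g := fun ω => S ω.1)
          (b := S ω.1) (by simp), prob_congr p (f := fun ω => ((), V ω)) (g := V) (b := V ω)
          (by simp)] at h1)
  rw [mutualInfo, condEntropy]
  linarith

lemma RevealsOnly.condMutualInfo_eq_zero (H : RevealsOnly V S) (hp : ∀ ω, p ω = D ω.1 * c)
    (hp0 : ∀ ω, 0 ≤ p ω) (f : E → γ) (s : γ → σ) (hs : ∀ e, S e = s (f e)) (d : E → γ') :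
    condMutualInfo p (fun ω => d ω.1) V (fun ω => f ω.1) = 0 := by
  have h := entropy_add_entropy_eq hp0 (f₁ := fun ω => (d ω.1, V ω, f ω.1))
    (f₂ := fun ω => f ω.1) (f₃ := fun ω => (V ω, f ω.1)) (f₄ := fun ω => (d ω.1, f ω.1))
    (fun ω _ => by
      have h1 := H.prob_mul_prob hp (fun e => (d e, f e)) f (d ω.1, f ω.1) (f ω.1) ω
      have h2 : ∀ ω' : E × R, (f ω'.1, S ω'.1) = (f ω.1, S ω.1) ↔ f ω'.1 = f ω.1 := by
        intro ω'
        simp only [Prod.mk.injEq, hs]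
        exact ⟨And.left, fun h => ⟨h, by rw [h]⟩⟩
      have h3 : ∀ ω' : E × R, ((d ω'.1, f ω'.1), S ω'.1) = ((d ω.1, f ω.1), S ω.1) ↔
          (d ω'.1, f ω'.1) = (d ω.1, f ω.1) := by
        intro ω'
        simp only [Prod.mk.injEq, hs]
        exact ⟨And.left, fun h => ⟨h, by rw [h.2]⟩⟩
      rwa [prob_congr p h2, prob_congr p h3,
        prob_congr p (f := fun ω => ((d ω.1, f ω.1), V ω)) (g := fun ω => (d ω.1, V ω, f ω.1))
          (b := (d ω.1, V ω, f ω.1)) (by simp only [Prod.mk.injEq]; tauto),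
        prob_congr p (f := fun ω => (f ω.1, V ω)) (g := fun ω => (V ω, f ω.1))
          (b := (V ω, f ω.1)) (by simp only [Prod.mk.injEq]; tauto)] at h1)
  rw [condMutualInfo, condEntropy, condEntropy]
  linarith

lemma RevealsOnly.mutualInfo_eq_zero (H : RevealsOnly V S) (hp : ∀ ω, p ω = D ω.1 * c)
    (hp0 : ∀ ω, 0 ≤ p ω) (hp1 : ∑ ω, p ω = 1) (d : E → γ)
    (hd : mutualInfo p (fun ω => d ω.1) (fun ω => S ω.1) = 0) :
    mutualInfo p (fun ω => d ω.1) V = 0 := by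
  refine mutualInfo_eq_zero_of_indep hp0 hp1 fun ω hω => ?_
  have h1 := H.prob_mul_prob hp d (fun _ => ()) (d ω.1) () ω
  rw [indep_of_mutualInfo_eq_zero hp0 hp1 hd,
    prob_congr p (f := fun ω => ((), V ω)) (g := V) (b := V ω) (by simp),
    prob_congr p (f := fun ω => ((), S ω.1)) (g := fun ω => S ω.1) (b := S ω.1) (by simp),
    ← mul_assoc] at h1
  rw [mul_right_cancel₀ (prob_pos hp0 (fun ω => S ω.1) hω).ne' h1, mul_comm]

end Leakage

/-! ### Segment-preserving permutations and their orbits on sets of subpackets -/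

section Orbits

lemma exists_perm_comp_eq {α γ : Type*} [Fintype α] [DecidableEq γ] (f g : α → γ)
    (h : ∀ c, (Finset.univ.filter fun a => f a = c).card =
      (Finset.univ.filter fun a => g a = c).card) :
    ∃ σ : Equiv.Perm α, ∀ a, g (σ a) = f a := by
  have e : ∀ c, Nonempty ({a // f a = c} ≃ {a // g a = c}) := fun c =>
    Fintype.card_eq.mp (by rw [Fintype.card_subtype, Fintype.card_subtype, h])
  exact ⟨Equiv.ofFiberEquiv fun c => (e c).some, fun a => Equiv.ofFiberEquiv_map _ a⟩

lemma segment_lt {P B : ℕ} (hBP : B ∣ P) (s : Fin P) : segment P B s < B := by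
  have := s.isLt
  obtain ⟨w, rfl⟩ := hBP
  have hB : 0 < B := Nat.pos_of_ne_zero (by rintro rfl; simp at this)
  rw [segment, Nat.mul_div_cancel_left _ hB]
  exact Nat.div_lt_of_lt_mul (by rwa [mul_comm w B])

/-- The segment of a subpacket, as an element of `Fin B`. -/
def seg {P B : ℕ} (hBP : B ∣ P) (s : Fin P) : Fin B := ⟨segment P B s, segment_lt hBP s⟩

lemma width_pos {P B : ℕ} (hBP : B ∣ P) (s : Fin P) : 0 < P / B := by
  obtain ⟨w, rfl⟩ := hBP
  have := s.isLt
  have hB : 0 < B := Nat.pos_of_ne_zero (by rintro rfl; simp at this)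
  rw [Nat.mul_div_cancel_left _ hB]
  exact Nat.pos_of_ne_zero (by rintro rfl; simp at this)

/-- The position of a subpacket within its segment. -/
def offset {P B : ℕ} (hBP : B ∣ P) (s : Fin P) : Fin (P / B) :=
  ⟨s.val % (P / B), Nat.mod_lt _ (width_pos hBP s)⟩

lemma eq_of_seg_eq_of_offset_eq {P B : ℕ} (hBP : B ∣ P) {s s' : Fin P}
    (h1 : seg hBP s = seg hBP s') (h2 : offset hBP s = offset hBP s') : s = s' := by
  have h1' : s.val / (P / B) = s'.val / (P / B) := congrArg Fin.val h1
  have h2' : s.val % (P / B) = s'.val % (P / B) := congrArg Fin.val h2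
  rw [Fin.ext_iff, ← Nat.div_add_mod s.val (P / B), h1', h2', Nat.div_add_mod]

lemma card_seg_eq {P B : ℕ} (hBP : B ∣ P) (b : Fin B) :
    (Finset.univ.filter fun s : Fin P => seg hBP s = b).card = P / B := by
  obtain ⟨w, rfl⟩ := hBP
  have hB : 0 < B := b.pos
  have hw : B * w / B = w := Nat.mul_div_cancel_left _ hB
  rw [← Finset.card_fin (B * w / B)]
  refine Finset.card_nbij' (fun s => offset ⟨w, rfl⟩ s)
    (fun i => ⟨i.val + w * b.val, ?_⟩) ?_ ?_ ?_ ?_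
  · have := i.isLt.trans_eq hw
    have h2 : w * (b.val + 1) ≤ w * B := Nat.mul_le_mul_left _ b.isLt
    linarith [mul_comm w B]
  · intro s _; simp
  · intro i _
    have := i.isLt.trans_eq hw
    simp only [Finset.coe_filter, Finset.mem_univ, true_and, Set.mem_ofPred_eq, seg, segment,
      Fin.ext_iff, hw]
    rw [Nat.add_mul_div_left _ _ (by omega), Nat.div_eq_of_lt this, zero_add]
  · intro s hs
    simp only [Finset.coe_filter, Finset.mem_univ, true_and, Set.mem_ofPred_eq, seg, segment,
      Fin.ext_iff, hw] at hs
    simp only [Fin.ext_iff, offset, hw, ← hs]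
    exact Nat.mod_add_div _ _
  · intro i _
    have := i.isLt.trans_eq hw
    simp only [Fin.ext_iff, offset, hw]
    rw [Nat.add_mul_mod_self_left, Nat.mod_eq_of_lt this]

lemma segmentCounts_eq {P B k : ℕ} (hBP : B ∣ P) (X : SparseSet P k) (b : Fin B) :
    segmentCounts B X b = (X.1.filter fun s => seg hBP s = b).card := by
  simp [segmentCounts, seg, Fin.ext_iff]

/-- The permutations of the subpackets that map segments to segments, permuting the segments
by an element of `Γ`. -/
def segmentPerms {P B : ℕ} (hBP : B ∣ P) (Γ : Subgroup (Equiv.Perm (Fin B))) :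
    Subgroup (Equiv.Perm (Fin P)) where
  carrier := {π | ∃ σ ∈ Γ, ∀ s, seg hBP (π s) = σ (seg hBP s)}
  one_mem' := ⟨1, Γ.one_mem, fun _ => rfl⟩
  mul_mem' := by
    rintro π π' ⟨σ, hσ, h⟩ ⟨σ', hσ', h'⟩
    exact ⟨σ * σ', Γ.mul_mem hσ hσ', fun s => by simp [h, h']⟩
  inv_mem' := by
    rintro π ⟨σ, hσ, h⟩
    refine ⟨σ⁻¹, Γ.inv_mem hσ, fun s => ?_⟩
    rw [Equiv.Perm.eq_inv_iff_eq, ← h, Equiv.Perm.coe_inv, Equiv.apply_symm_apply]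

/-- Two sets of subpackets of the same cardinality lie in the same orbit if and only if their
vectors of segment counts do. -/
lemma exists_segmentPerms_map_eq_iff {P B k : ℕ} (hBP : B ∣ P)
    (Γ : Subgroup (Equiv.Perm (Fin B))) (X X' : SparseSet P k) :
    (∃ π ∈ segmentPerms hBP Γ, X'.1 = X.1.map π.toEmbedding) ↔
      ∃ σ ∈ Γ, ∀ b, segmentCounts B X' (σ b) = segmentCounts B X b := by
  constructor
  · rintro ⟨π, ⟨σ, hσ, h⟩, hX⟩
    refine ⟨σ, hσ, fun b => ?_⟩
    rw [segmentCounts_eq hBP, segmentCounts_eq hBP, hX, Finset.filter_map, Finset.card_map]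
    simp [h]
  · rintro ⟨σ, hσ, h⟩
    -- colour a subpacket by its segment and by whether it belongs to the set
    obtain ⟨π, hπ⟩ := exists_perm_comp_eq (fun s => (σ (seg hBP s), decide (s ∈ X.1)))
      (fun s => (seg hBP s, decide (s ∈ X'.1))) (by
        rintro ⟨b, c⟩
        obtain ⟨b, rfl⟩ := σ.surjective b
        have e1 : ∀ Y : SparseSet P k, ∀ b, (Finset.univ.filter fun s =>
            seg hBP s = b ∧ s ∈ Y.1).card = segmentCounts B Y b := by
          intro Y b
          rw [segmentCounts_eq hBP]
          congr 1
          ext s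
          simp [and_comm]
        have e2 : ∀ Y : SparseSet P k, ∀ b, (Finset.univ.filter fun s =>
            seg hBP s = b ∧ s ∈ Y.1).card + (Finset.univ.filter fun s =>
            seg hBP s = b ∧ s ∉ Y.1).card = P / B := by
          intro Y b
          rw [← card_seg_eq hBP b, ← Finset.filter_filter, ← Finset.filter_filter,
            Finset.card_filter_add_card_filter_not]
        have e3 := e2 X b
        have e4 := e2 X' (σ b)
        rw [e1] at e3 e4
        have := h b
        cases c
        · simp only [Prod.mk.injEq, decide_eq_false_iff_not, σ.injective.eq_iff]
          omega
        · simp only [Prod.mk.injEq, decide_eq_true_eq, σ.injective.eq_iff]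
          rw [e1, e1, this])
    simp only [Prod.mk.injEq, decide_eq_decide] at hπ
    refine ⟨π, ⟨σ, hσ, fun s => (hπ s).1⟩, ?_⟩
    ext s
    obtain ⟨s, rfl⟩ := π.surjective s
    simp [(hπ s).2]

lemma segmentCounts_eq_iff {P B k : ℕ} (hBP : B ∣ P) (X X' : SparseSet P k) :
    segmentCounts B X = segmentCounts B X' ↔
      ∃ π ∈ segmentPerms hBP ⊥, X'.1 = X.1.map π.toEmbedding := by
  rw [exists_segmentPerms_map_eq_iff]
  simp [funext_iff, eq_comm]

lemma unorderedCounts_eq_iff {P B k : ℕ} (hBP : B ∣ P) (X X' : SparseSet P k) :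
    unorderedCounts B X = unorderedCounts B X' ↔
      ∃ π ∈ segmentPerms hBP ⊤, X'.1 = X.1.map π.toEmbedding := by
  rw [exists_segmentPerms_map_eq_iff]
  simp only [Subgroup.mem_top, true_and]
  constructor
  · intro h
    refine exists_perm_comp_eq _ _ fun c => ?_
    have := congrArg (Multiset.count c) h
    simp only [unorderedCounts, Multiset.count_map] at this
    simpa only [Finset.card_def, Finset.filter_val, eq_comm (a := c)] using this
  · rintro ⟨σ, h⟩
    have : segmentCounts B X = segmentCounts B X' ∘ σ := funext fun b => (h b).symm
    rw [unorderedCounts, unorderedCounts, this, ← Multiset.map_map, Multiset.map_univ_val_equiv]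

end Orbits

/-! ### Polynomial encoding and MDS codes -/

section Encoding

variable {F : Type*} [Field F] {N ℓ : ℕ}

/-- The symbols `y n` are the values at the points `x n` of a polynomial of degree at most `D`
whose coefficients below `ℓ` are the data `w`; the other coefficients are noise. -/
def Encodes (x : Fin N → F) (D : ℕ) (w : Fin ℓ → F) (y : Fin N → F) : Prop :=
  ∃ p : F[X], p.natDegree ≤ D ∧ (∀ i : Fin ℓ, p.coeff i = w i) ∧ ∀ n, y n = p.eval (x n)

variable {x : Fin N → F} {D : ℕ}

lemma Encodes.zero : Encodes x D (0 : Fin ℓ → F) 0 :=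
  ⟨0, by simp, by simp, by simp⟩

lemma Encodes.add {w w' : Fin ℓ → F} {y y' : Fin N → F} (h : Encodes x D w y)
    (h' : Encodes x D w' y') : Encodes x D (w + w') (y + y') := by
  obtain ⟨p, h1, h2, h3⟩ := h
  obtain ⟨p', h1', h2', h3'⟩ := h'
  exact ⟨p + p', natDegree_add_le_of_degree_le h1 h1', fun i => by simp [h2, h2'],
    fun n => by simp [h3, h3']⟩

lemma Encodes.sum {ι : Type*} (s : Finset ι) {w : ι → Fin ℓ → F} {y : ι → Fin N → F}
    (h : ∀ i ∈ s, Encodes x D (w i) (y i)) : Encodes x D (∑ i ∈ s, w i) (∑ i ∈ s, y i) := by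
  classical
  induction s using Finset.induction_on with
  | empty => simpa using Encodes.zero
  | insert i s hi ih =>
    rw [Finset.sum_insert hi, Finset.sum_insert hi]
    exact (h i (Finset.mem_insert_self i s)).add
      (ih fun j hj => h j (Finset.mem_insert_of_mem hj))

/-- Multiplication by the values of a polynomial that is a constant modulo `X ^ ℓ` scales the
encoded data. -/
lemma Encodes.mul {w : Fin ℓ → F} {y : Fin N → F} (h : Encodes x D w y) {D' : ℕ} {Q : F[X]}
    (hQ : Q.natDegree ≤ D') {b : F} (hb : X ^ ℓ ∣ Q - C b) :
    Encodes x (D' + D) (b • w) (fun n => Q.eval (x n) * y n) := by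
  obtain ⟨p, h1, h2, h3⟩ := h
  obtain ⟨R, hR⟩ := hb
  refine ⟨Q * p, natDegree_mul_le_of_le hQ h1, fun i => ?_, fun n => by simp [h3]⟩
  rw [sub_eq_iff_eq_add.mp hR, add_mul, coeff_add, mul_assoc, coeff_X_pow_mul', coeff_C_mul, h2]
  simp

/-- Data masked by one noise symbol in degree `ℓ`. -/
lemma encodes_masked (w : Fin ℓ → F) (z : F) :
    Encodes x ℓ w (fun n => ∑ i, w i * x n ^ i.val + z * x n ^ ℓ) := by
  refine ⟨∑ i : Fin ℓ, C (w i) * X ^ i.val + C z * X ^ ℓ, ?_, fun i => ?_, fun n => ?_⟩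
  · refine natDegree_add_le_of_degree_le (natDegree_sum_le_of_forall_le _ _ fun i _ => ?_)
      (natDegree_C_mul_X_pow_le _ _)
    exact (natDegree_C_mul_X_pow_le _ _).trans i.isLt.le
  · rw [coeff_add, finsetSum_coeff, Finset.sum_eq_single i]
    · simp [i.isLt.ne]
    · intro j _ hj
      simp [coeff_X_pow, Fin.val_inj, hj.symm]
    · simp
  · simp [eval_finsetSum]

lemma Encodes.interpolate_coeff (hx : Function.Injective x) {w : Fin ℓ → F} {y : Fin N → F}
    (h : Encodes x D w y) (hD : D < N) (i : Fin ℓ) :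
    (Lagrange.interpolate Finset.univ x y).coeff i = w i := by
  obtain ⟨p, h1, h2, h3⟩ := h
  rw [← Lagrange.eq_interpolate_of_eval_eq y hx.injOn (f := p), h2]
  · refine (degree_le_of_natDegree_le h1).trans_lt ?_
    rw [Finset.card_univ, Fintype.card_fin]
    exact_mod_cast hD
  · exact fun n _ => (h3 n).symm

lemma Encodes.exists_noise {w : Fin ℓ → F} {y : Fin N → F} {m : ℕ}
    (h : Encodes x D w y) (hD : D < ℓ + m) :
    ∃ z : Fin m → F, ∀ n, y n = ∑ i, w i * x n ^ i.val + ∑ i, z i * x n ^ (ℓ + i.val) := by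
  obtain ⟨p, h1, h2, h3⟩ := h
  refine ⟨fun i => p.coeff (ℓ + i), fun n => ?_⟩
  rw [h3, eval_eq_sum_range' (h1.trans_lt hD), Finset.sum_range_add, Finset.sum_range,
    Finset.sum_range]
  simp [h2]

lemma isUnit_det_monomials {κ : Type} [Fintype κ] [DecidableEq κ] {r : ℕ} (e : κ ≃ Fin r)
    {x : κ → F} (hx : Function.Injective x) :
    IsUnit (Matrix.of fun i j : κ => x j ^ (e i).val).det := by
  have : (Matrix.of fun i j : κ => x j ^ (e i).val) =
      (Matrix.vandermonde (x ∘ e.symm)).transpose.submatrix e e := by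
    ext i j
    simp [Matrix.vandermonde_apply]
  rw [this, Matrix.det_submatrix_equiv_self, Matrix.det_transpose, isUnit_iff_ne_zero,
    Matrix.det_vandermonde_ne_zero_iff]
  exact hx.comp e.symm.injective

end Encoding

lemma isMDS_monomials {F : Type} [Field F] {N ℓ : ℕ} {x : Fin N → F}
    (hx : Function.Injective x) (h : ℓ ≤ N) :
    IsMDS (Matrix.of fun (i : Fin ℓ) n => x n ^ i.val) := by
  refine ⟨by simpa using h, fun c => ?_⟩
  exact isUnit_det_monomials (finCongr (by simp)) (hx.comp c.injective)

lemma isMDS_fromRows_monomials {F : Type} [Field F] {N ℓ m : ℕ} {x : Fin N → F}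
    (hx : Function.Injective x) (h : ℓ + m ≤ N) :
    IsMDS (Matrix.fromRows (Matrix.of fun (i : Fin ℓ) n => x n ^ i.val)
      (Matrix.of fun (i : Fin m) n => x n ^ (ℓ + i.val))) := by
  refine ⟨by simpa using h, fun c => ?_⟩
  convert isUnit_det_monomials finSumFinEquiv (hx.comp c.injective) using 2
  ext i j
  rcases i with i | i <;> simp

/-! ### The scheme -/

/-- A family of secret permutations together with a way to store them at the databases. The
permutation `π` is represented by its `mark`s; a database with evaluation point `x` stores them
masked as `mark π i + z i * x ^ ℓ` and computes from them the entries `access _ s p` of a noisy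
permutation matrix. As functions of `x`, these entries are polynomials of degree at most `d * ℓ`
that are congruent modulo `X ^ ℓ` to the entries of the permutation matrix itself. -/
structure Addressing (F : Type) [Field F] (P ℓ d : ℕ) where
  /-- The possible permutations, from permuted to real indices. -/
  perms : Subgroup (Equiv.Perm (Fin P))
  /-- The positions of the stored marks. -/
  Entry : Type
  [fintypeEntry : Fintype Entry]
  /-- The marks that represent a permutation. -/
  mark : Equiv.Perm (Fin P) → Entry → F
  /-- The entry of the noisy permutation matrix at a real and a permuted index. -/
  access : (Entry → F) → Fin P → Fin P → F
  access_spec : ∀ π ∈ perms, ∀ (z : Entry → F) (s p : Fin P), ∃ Q : F[X],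
    Q.natDegree ≤ d * ℓ ∧ X ^ ℓ ∣ Q - C (if π p = s then 1 else 0) ∧
    ∀ x, access (fun i => mark π i + z i * x ^ ℓ) s p = Q.eval x

attribute [instance] Addressing.fintypeEntry

/-- The evaluation at `x` of the polynomial with coefficients `w` below degree `ℓ`, and the
noise symbol `z` in degree `ℓ`. -/
def masked {F : Type} [Field F] {ℓ : ℕ} (x : F) (w : Fin ℓ → F) (z : F) : F :=
  ∑ i, w i * x ^ i.val + z * x ^ ℓ

/-- A shift of the noise makes up for a change of the masked data. -/
lemma masked_add {F : Type} [Field F] {ℓ : ℕ} {x : F} (hx : x ≠ 0) (w w' : Fin ℓ → F) (z : F) :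
    masked x w' (z + (masked x w 0 - masked x w' 0) * (x ^ ℓ)⁻¹) = masked x w z := by
  simp only [masked]
  field_simp
  ring

/-- The set of the permuted indices of the elements of `X`. -/
def permutedSet {P k : ℕ} (π : Equiv.Perm (Fin P)) (X : SparseSet P k) : SparseSet P k :=
  ⟨X.1.map π.symm.toEmbedding, by rw [Finset.card_map, X.2]⟩

/-- The permuted indices of the elements of `X`, listed in increasing order: a listing in the
order of the real indices would reveal more than the permuted set. -/
def permutedIndex {P k : ℕ} (π : Equiv.Perm (Fin P)) (X : SparseSet P k) (i : Fin k) : Fin P :=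
  (permutedSet π X).1.orderEmbOfFin (permutedSet π X).2 i

lemma image_permutedIndex {P k : ℕ} (π : Equiv.Perm (Fin P)) (X : SparseSet P k) :
    Finset.univ.image (permutedIndex π X) = (permutedSet π X).1 :=
  Finset.image_orderEmbOfFin_univ _ _

lemma permutedSet_map {P k : ℕ} (π : Equiv.Perm (Fin P)) (X : SparseSet P k) :
    (permutedSet π X).1.map π.toEmbedding = X.1 := by
  ext s
  simp [permutedSet]

lemma increment_of_notMem {F : Type} [Field F] {P ℓ k : ℕ} (u : Update F P ℓ k) {s : Fin P}
    (hs : s ∉ u.1.1) : increment u s = 0 := by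
  rw [increment, dif_neg hs]

lemma sum_increment_permutedIndex {F : Type} [Field F] {P ℓ k : ℕ} (π : Equiv.Perm (Fin P))
    (u : Update F P ℓ k) (s : Fin P) :
    ∑ i, (if π (permutedIndex π u.1 i) = s then (1 : F) else 0) •
      increment u (π (permutedIndex π u.1 i)) = increment u s := by
  by_cases hs : s ∈ u.1.1
  · have h1 : π.symm s ∈ Finset.univ.image (permutedIndex π u.1) := by
      rw [image_permutedIndex]
      simpa [permutedSet] using hs
    obtain ⟨i, -, hi⟩ := Finset.mem_image.mp h1
    have hi' : π (permutedIndex π u.1 i) = s := by rw [hi]; simp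
    rw [Finset.sum_eq_single i]
    · rw [if_pos hi', one_smul, hi']
    · intro j _ hj
      rw [if_neg, zero_smul]
      intro h
      have := π.injective (h.trans hi'.symm)
      exact hj (((permutedSet π u.1).1.orderEmbOfFin (permutedSet π u.1).2).injective this)
    · simp
  · rw [increment_of_notMem u hs]
    refine Finset.sum_eq_zero fun i _ => ?_
    split_ifs with h
    · rw [h, increment_of_notMem u hs, smul_zero]
    · rw [zero_smul]

namespace Addressing

variable {F : Type} [Field F] {N P ℓ d : ℕ}

/-- The scheme in which database `n` holds values at the point `x n` of polynomials that carry
the data in their coefficients below degree `ℓ`, and addresses the subpackets by means of a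
noisy permutation matrix. To update, it multiplies the matrix by the masked updates and adds the
result to its storage; to answer, it multiplies the transposed matrix by its storage. -/
noncomputable def scheme [Fintype F] (𝒜 : Addressing F P ℓ d) (x : Fin N → F) (k k' M : ℕ) :
    Scheme F N P ℓ k k' M where
  Key := 𝒜.perms
  Noise := (Fin P → F) × (𝒜.Entry → F)
  UserNoise := Fin k → F
  Aux _ := 𝒜.Entry → F
  Upload _ := Fin k → Fin P × F
  Announcement := Fin k' → Fin P
  Answer _ := Fin k' → F
  fintypeKey := Fintype.ofFinite _
  fintypeNoise := by classical infer_instance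
  fintypeUserNoise := by classical infer_instance
  fintypeAux _ := by classical infer_instance
  fintypeUpload _ := by classical infer_instance
  fintypeAnnouncement := by classical infer_instance
  fintypeAnswer _ := by classical infer_instance
  perm K := K
  initCoded _ z W n s := masked (x n) (W s) (z.1 s)
  initAux K z n i := 𝒜.mark K i + z.2 i * x n ^ ℓ
  upload K z u n i := (permutedIndex K u.1 i,
    masked (x n) (increment u (K.1 (permutedIndex K u.1 i))) (z i))
  uploadedIndices _ m := Finset.univ.image fun i => (m i).1
  write _ c a m s := c s + ∑ u, ∑ i, 𝒜.access a s (m u i).1 * (m u i).2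
  announce v := v
  answer _ c a v i := ∑ s, 𝒜.access a s (v i) * c s
  decodeIndices K v i := K.1 (v i)
  decode _ y i j := (Lagrange.interpolate Finset.univ x fun n => y n i).coeff j

/-! ### Correctness of writing and reading -/

lemma encodes_access (𝒜 : Addressing F P ℓ d) (x : Fin N → F) (K : 𝒜.perms) (z : 𝒜.Entry → F) (s p : Fin P) {D : ℕ} {w : Fin ℓ → F}
    {y : Fin N → F} (h : Encodes x D w y) :
    Encodes x (d * ℓ + D) ((if K.1 p = s then (1 : F) else 0) • w)
      (fun n => 𝒜.access (fun i => 𝒜.mark K i + z i * x n ^ ℓ) s p * y n) := by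
  obtain ⟨Q, h1, h2, h3⟩ := 𝒜.access_spec K K.2 z s p
  simp only [h3]
  exact h.mul h1 h2

variable [Fintype F] (𝒜 : Addressing F P ℓ d) (x : Fin N → F) (k k' M : ℕ)

lemma encodes_codedAt {T : ℕ} (ω : (𝒜.scheme x k k' M).Outcome T) (t : ℕ) (s : Fin P) :
    Encodes x (d * ℓ + ℓ) ((𝒜.scheme x k k' M).modelAt t ω s)
      (fun n => (𝒜.scheme x k k' M).codedAt n ω t s) := by
  induction t with
  | zero =>
    obtain ⟨p, h1, h2⟩ := encodes_masked (x := x) (ω.1.1 s) (ω.2.2.1.1 s)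
    exact ⟨p, h1.trans (Nat.le_add_left _ _), h2⟩
  | succ t ih =>
    by_cases h : t < T
    · have h1 : (𝒜.scheme x k k' M).modelAt (t + 1) ω s =
          (𝒜.scheme x k k' M).modelAt t ω s + ∑ u, increment (ω.1.2 ⟨t, h⟩ u) s := by
        simp only [Scheme.modelAt, Env.model, dif_pos h]
      have h2 : (fun n => (𝒜.scheme x k k' M).codedAt n ω (t + 1) s) =
          (fun n => (𝒜.scheme x k k' M).codedAt n ω t s) + ∑ u, ∑ i, fun n =>
            𝒜.access (fun j => 𝒜.mark ω.2.1.1 j + ω.2.2.1.2 j * x n ^ ℓ) s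
              (permutedIndex ω.2.1.1 (ω.1.2 ⟨t, h⟩ u).1 i) *
            masked (x n) (increment (ω.1.2 ⟨t, h⟩ u)
              (ω.2.1.1 (permutedIndex ω.2.1.1 (ω.1.2 ⟨t, h⟩ u).1 i))) (ω.2.2.2 ⟨t, h⟩ u i) := by
        funext n
        simp only [Scheme.codedAt, dif_pos h, Pi.add_apply, Finset.sum_apply]
        rfl
      rw [h1, h2]
      refine ih.add (Encodes.sum _ fun u _ => ?_)
      rw [← sum_increment_permutedIndex ω.2.1.1 (ω.1.2 ⟨t, h⟩ u) s]
      exact Encodes.sum _ fun i _ => 𝒜.encodes_access x ω.2.1 _ _ _ (encodes_masked _ _)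
    · have h1 : (𝒜.scheme x k k' M).modelAt (t + 1) ω s =
          (𝒜.scheme x k k' M).modelAt t ω s := by
        simp only [Scheme.modelAt, Env.model, dif_neg h]
      have h2 : ∀ n, (𝒜.scheme x k k' M).codedAt n ω (t + 1) s =
          (𝒜.scheme x k k' M).codedAt n ω t s := fun n => by
        simp only [Scheme.codedAt, dif_neg h]
      simpa only [h1, h2] using ih

lemma storesModel {x : Fin N → F} (hx : Function.Injective x) (hN : d * ℓ + ℓ < N) :
    (𝒜.scheme x k k' M).StoresModel :=
  ⟨d * ℓ + 1, _, _, isMDS_monomials hx (by omega), isMDS_fromRows_monomials hx (by omega),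
    fun _ ω t _ s => (𝒜.encodes_codedAt x k k' M ω t s).exists_noise (by omega)⟩

lemma uploadsIndices : (𝒜.scheme x k k' M).UploadsIndices := by
  intro K z u n
  change (Finset.univ.image (permutedIndex K.1 u.1)).map K.1.toEmbedding = u.1.1
  rw [image_permutedIndex, permutedSet_map]

lemma decode_eq {x : Fin N → F} (hx : Function.Injective x) (hN : 2 * d * ℓ + ℓ < N) {T : ℕ}
    (ω : (𝒜.scheme x k k' M).Outcome T) (t : ℕ) (v : Fin k' ↪ Fin P) (i : Fin k') :
    (𝒜.scheme x k k' M).decode ((𝒜.scheme x k k' M).downloadAt t v ω).1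
        ((𝒜.scheme x k k' M).downloadAt t v ω).2 i =
      (𝒜.scheme x k k' M).modelAt t ω ((𝒜.scheme x k k' M).perm ω.2.1 (v i)) := by
  have h : Encodes x (d * ℓ + (d * ℓ + ℓ))
      (∑ s, (if ω.2.1.1 (v i) = s then (1 : F) else 0) • (𝒜.scheme x k k' M).modelAt t ω s)
      (∑ s, fun n => 𝒜.access (fun j => 𝒜.mark ω.2.1.1 j + ω.2.2.1.2 j * x n ^ ℓ) s (v i) *
        (𝒜.scheme x k k' M).codedAt n ω t s) :=
    Encodes.sum _ fun s _ => 𝒜.encodes_access x ω.2.1 _ _ _ (𝒜.encodes_codedAt x k k' M ω t s)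
  simp only [ite_smul, one_smul, zero_smul, Finset.sum_ite_eq, Finset.mem_univ, if_true] at h
  funext j
  refine Eq.trans ?_ (h.interpolate_coeff hx (by linarith) j)
  change (Lagrange.interpolate Finset.univ x _).coeff _ = _
  congr 2
  funext n
  rw [Finset.sum_apply]
  rfl

lemma readsCorrectly {x : Fin N → F} (hx : Function.Injective x) (hN : 2 * d * ℓ + ℓ < N) :
    (𝒜.scheme x k k' M).ReadsCorrectly :=
  ⟨fun _ ω t _ v i => ⟨rfl, 𝒜.decode_eq k k' M hx hN ω t v i⟩, fun _ _ _ t _ v =>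
    condEntropy_eq_zero_of_comp _
      (fun y => (𝒜.scheme x k k' M).decode y.1 y.2)
      (fun ω => funext fun i => (𝒜.decode_eq k k' M hx hN ω t (v ω) i).symm)⟩

end Addressing

/-! ### Security, privacy of the values and leakage of the indices -/

section Weight

variable {F : Type} {N P ℓ k k' M : ℕ} (𝒮 : Scheme F N P ℓ k k' M)
  {T : ℕ} {D : Env F P ℓ k M T → ℝ}

/-- The probability of an outcome of the randomness of the coordinator and the users. -/
noncomputable def Scheme.uniformWeight (T : ℕ) : ℝ :=
  (Fintype.card 𝒮.Key : ℝ)⁻¹ * (Fintype.card 𝒮.Noise : ℝ)⁻¹ *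
    (Fintype.card (Fin T → Fin M → 𝒮.UserNoise) : ℝ)⁻¹

lemma Scheme.weight_eq (ω : 𝒮.Outcome T) : 𝒮.weight D ω = D ω.1 * 𝒮.uniformWeight T := by
  simp only [Scheme.weight, Scheme.uniformWeight, mul_assoc]

variable [Fintype F]

lemma Scheme.weight_nonneg (hD : D ∈ stdSimplex ℝ _) (ω : 𝒮.Outcome T) : 0 ≤ 𝒮.weight D ω := by
  rw [weight_eq, uniformWeight]
  have := hD.1 ω.1
  positivity

lemma Scheme.sum_weight (hD : D ∈ stdSimplex ℝ _) : ∑ ω, 𝒮.weight (T := T) D ω = 1 := by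
  simp only [weight_eq]
  rw [Fintype.sum_prod_type]
  simp only [Finset.sum_const, Finset.card_univ, nsmul_eq_mul, Fintype.card_prod]
  rw [← Finset.mul_sum, ← Finset.sum_mul, hD.2, uniformWeight, one_mul]
  have h1 : (Fintype.card 𝒮.Key : ℝ) ≠ 0 := by simp
  have h2 : (Fintype.card 𝒮.Noise : ℝ) ≠ 0 := by simp
  have h3 : (Fintype.card (Fin T → Fin M → 𝒮.UserNoise) : ℝ) ≠ 0 := by
    exact_mod_cast Fintype.card_ne_zero
  push_cast
  field_simp

end Weight

namespace Addressing

variable {F : Type} [Field F] [Fintype F] {N P ℓ d : ℕ} (𝒜 : Addressing F P ℓ d)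
  {x : Fin N → F} (k k' M : ℕ) {T : ℕ}

/-- The storage noise of the coordinator is never touched: it only shifts the content. -/
lemma codedAt_eq_add (n : Fin N) (e : Env F P ℓ k M T) (K : 𝒜.perms) (c : Fin P → F)
    (a : 𝒜.Entry → F) (z : Fin T → Fin M → Fin k → F) (t : ℕ) (s : Fin P) :
    (𝒜.scheme x k k' M).codedAt n (e, K, (c, a), z) t s =
      (𝒜.scheme x k k' M).codedAt n (e, K, (0, a), z) t s + c s * x n ^ ℓ := by
  induction t with
  | zero =>
    change masked _ _ (c s) = masked _ _ 0 + _
    simp [masked]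
  | succ t ih =>
    by_cases h : t < T
    · simp only [Scheme.codedAt, dif_pos h]
      change (𝒜.scheme x k k' M).codedAt n (e, K, (c, a), z) t s + _ =
        (𝒜.scheme x k k' M).codedAt n (e, K, (0, a), z) t s + _ + _
      rw [ih, add_right_comm]
      rfl
    · simpa only [Scheme.codedAt, dif_neg h] using ih

/-- The storage noise that makes up for a change of environment, key, and all other noise. -/
lemma codedAt_shift {n : Fin N} (hx : x n ≠ 0) (e e' : Env F P ℓ k M T) (K K' : 𝒜.perms)
    (c : Fin P → F) (a a' : 𝒜.Entry → F) (z z' : Fin T → Fin M → Fin k → F) (t : ℕ) :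
    (𝒜.scheme x k k' M).codedAt n (e', K', (c + fun s =>
        ((𝒜.scheme x k k' M).codedAt n (e, K, (0, a), z) t s -
          (𝒜.scheme x k k' M).codedAt n (e', K', (0, a'), z') t s) * (x n ^ ℓ)⁻¹, a'), z') t =
      (𝒜.scheme x k k' M).codedAt n (e, K, (c, a), z) t := by
  funext s
  rw [codedAt_eq_add, codedAt_eq_add _ _ _ _ n e K c, Pi.add_apply]
  field_simp
  ring

/-- The content of a database reveals nothing on the initial model and the updates. -/
lemma revealsOnly_content (n : Fin N) (hx : x n ≠ 0) (t : ℕ) :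
    RevealsOnly (R := (𝒜.scheme x k k' M).Key × (𝒜.scheme x k k' M).Noise ×
        (Fin T → Fin M → (𝒜.scheme x k k' M).UserNoise))
      ((𝒜.scheme x k k' M).contentAt (T := T) n t) (fun _ => ()) where
  reads _ _ _ _ _ := rfl
  hides e e' _ := by
    refine ⟨fun r => (r.1, (r.2.1.1 + fun s =>
        ((𝒜.scheme x k k' M).codedAt n (e, r.1, (0, r.2.1.2), r.2.2) t s -
          (𝒜.scheme x k k' M).codedAt n (e', r.1, (0, r.2.1.2), r.2.2) t s) * (x n ^ ℓ)⁻¹,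
        r.2.1.2), r.2.2), ?_, ?_⟩
    · rintro ⟨K, ⟨c, a⟩, z⟩ ⟨K', ⟨c', a'⟩, z'⟩ h
      obtain rfl : K = K' := congrArg (fun r => r.1) h
      obtain rfl : a = a' := congrArg (fun r => r.2.1.2) h
      obtain rfl : z = z' := congrArg (fun r => r.2.2) h
      obtain rfl : c = c' :=
        add_right_cancel (G := Fin P → F) (congrArg (fun r => r.2.1.1) h)
      rfl
    · rintro ⟨K, ⟨c, a⟩, z⟩
      exact Prod.ext (𝒜.codedAt_shift k k' M hx e e' K K c a a z z t) rfl

lemma secure {x : Fin N → F} (hx : ∀ n, x n ≠ 0) : (𝒜.scheme x k k' M).Secure := by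
  intro T D hD t _ n
  refine (𝒜.revealsOnly_content k k' M n (hx n) t).mutualInfo_eq_zero (D := D)
    (c := (𝒜.scheme x k k' M).uniformWeight T) (fun ω => Scheme.weight_eq _ ω)
    (Scheme.weight_nonneg _ hD) (Scheme.sum_weight _ hD)
    (fun e : Env F P ℓ k M T => e.model t) ?_
  refine mutualInfo_eq_zero_of_indep (Scheme.weight_nonneg _ hD) (Scheme.sum_weight _ hD)
    fun ω _ => ?_
  rw [prob_const (Scheme.sum_weight _ hD) (fun _ => ()) (fun _ => rfl), mul_one]
  exact prob_congr _ (by simp)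

variable {k} {α : Type} {stat : SparseSet P k → α}

/-- Uploads that look the same come from sets in the same orbit of the permutations. -/
lemma stat_eq_of_upload_eq
    (hstat : ∀ X X', stat X = stat X' ↔ ∃ π ∈ 𝒜.perms, X'.1 = X.1.map π.toEmbedding)
    (n : Fin N) (t : Fin T) (u : Fin M) (ω ω' : (𝒜.scheme x k k' M).Outcome T)
    (h : (𝒜.scheme x k k' M).uploadAt t u n ω = (𝒜.scheme x k k' M).uploadAt t u n ω') :
    stat (ω.1.2 t u).1 = stat (ω'.1.2 t u).1 := by
  have h1 := (𝒜.uploadsIndices x k k' M) ω.2.1 (ω.2.2.2 t u) (ω.1.2 t u) n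
  have h2 := (𝒜.uploadsIndices x k k' M) ω'.2.1 (ω'.2.2.2 t u) (ω'.1.2 t u) n
  have h3 : (𝒜.scheme x k k' M).upload ω.2.1 (ω.2.2.2 t u) (ω.1.2 t u) n =
    (𝒜.scheme x k k' M).upload ω'.2.1 (ω'.2.2.2 t u) (ω'.1.2 t u) n := h
  rw [hstat, ← h1, ← h2, h3]
  refine ⟨ω'.2.1.1 * ω.2.1.1⁻¹, 𝒜.perms.mul_mem ω'.2.1.2 (𝒜.perms.inv_mem ω.2.1.2), ?_⟩
  rw [Finset.map_map]
  congr 1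
  refine DFunLike.ext _ _ fun p => ?_
  change ω'.2.1.1 p = (ω'.2.1.1 * ω.2.1.1⁻¹) (ω.2.1.1 p)
  simp

/-- What a database has and receives reveals the orbit of the set of updated subpackets, and
nothing else on the initial model and the updates. -/
lemma revealsOnly_content_upload
    (hstat : ∀ X X', stat X = stat X' ↔ ∃ π ∈ 𝒜.perms, X'.1 = X.1.map π.toEmbedding)
    (n : Fin N) (hx : x n ≠ 0) (t : Fin T) (u : Fin M) :
    RevealsOnly (R := (𝒜.scheme x k k' M).Key × (𝒜.scheme x k k' M).Noise ×
        (Fin T → Fin M → (𝒜.scheme x k k' M).UserNoise))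
      (fun ω : (𝒜.scheme x k k' M).Outcome T =>
        ((𝒜.scheme x k k' M).contentAt n t ω, (𝒜.scheme x k k' M).uploadAt t u n ω))
      (fun e : Env F P ℓ k M T => stat (e.2 t u).1) where
  reads e r e' r' h :=
    𝒜.stat_eq_of_upload_eq k' M hstat n t u (e, r) (e', r') (Prod.mk.inj h).2
  hides e e' h := by
    classical
    obtain ⟨π, hπ, hX⟩ := (hstat _ _).mp h
    -- the key, the marks and the user's noise are shifted so that the database sees no
    -- difference, then the storage noise makes up for the change of the storage
    let key : 𝒜.perms → 𝒜.perms := fun K => ⟨π, hπ⟩ * K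
    let marks : 𝒜.perms → (𝒜.Entry → F) → 𝒜.Entry → F := fun K a =>
      a + fun i => (𝒜.mark K i - 𝒜.mark (key K) i) * (x n ^ ℓ)⁻¹
    let symbol : 𝒜.perms → Env F P ℓ k M T → Fin k → F := fun K e i =>
      masked (x n) (increment (e.2 t u) (K.1 (permutedIndex K (e.2 t u).1 i))) 0
    let noise : 𝒜.perms → (Fin T → Fin M → Fin k → F) → Fin T → Fin M → Fin k → F :=
      fun K z => z + Pi.single t (Pi.single u
        fun i => (symbol K e i - symbol (key K) e' i) * (x n ^ ℓ)⁻¹)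
    refine ⟨fun r => (key r.1, (r.2.1.1 + fun s =>
        ((𝒜.scheme x k k' M).codedAt n (e, r.1, (0, r.2.1.2), r.2.2) t s -
          (𝒜.scheme x k k' M).codedAt n (e', key r.1, (0, marks r.1 r.2.1.2),
            noise r.1 r.2.2) t s) * (x n ^ ℓ)⁻¹,
        marks r.1 r.2.1.2), noise r.1 r.2.2), ?_, ?_⟩
    · rintro ⟨K, ⟨c, a⟩, z⟩ ⟨K', ⟨c', a'⟩, z'⟩ h
      obtain rfl : K = K' := mul_left_cancel (G := 𝒜.perms) (congrArg (fun r => r.1) h)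
      obtain rfl : a = a' :=
        add_right_cancel (G := 𝒜.Entry → F) (congrArg (fun r => r.2.1.2) h)
      obtain rfl : z = z' :=
        add_right_cancel (G := Fin T → Fin M → Fin k → F) (congrArg (fun r => r.2.2) h)
      obtain rfl : c = c' :=
        add_right_cancel (G := Fin P → F) (congrArg (fun r => r.2.1.1) h)
      rfl
    · rintro ⟨K, ⟨c, a⟩, z⟩
      have hset : permutedSet (key K).1 (e'.2 t u).1 = permutedSet K.1 (e.2 t u).1 := by
        apply Subtype.ext
        simp only [permutedSet, hX, Finset.map_map]
        congr 1
        refine DFunLike.ext _ _ fun s => ?_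
        change K.1.symm (π.symm (π s)) = K.1.symm s
        rw [Equiv.symm_apply_apply]
      have hindex : permutedIndex (key K).1 (e'.2 t u).1 = permutedIndex K.1 (e.2 t u).1 := by
        funext i
        simp only [permutedIndex, hset]
      refine Prod.ext (Prod.ext (𝒜.codedAt_shift k k' M hx e e' K _ c a _ z _ t) ?_) ?_
      · funext i
        change 𝒜.mark (key K).1 i +
          (a i + (𝒜.mark K.1 i - 𝒜.mark (key K).1 i) * (x n ^ ℓ)⁻¹) * x n ^ ℓ =
          𝒜.mark K.1 i + a i * x n ^ ℓ
        field_simp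
        ring
      · funext i
        have hz : noise K z t u i =
            z t u i + (symbol K e i - symbol (key K) e' i) * (x n ^ ℓ)⁻¹ := by
          change z t u i + (Pi.single t (Pi.single u
            fun i => (symbol K e i - symbol (key K) e' i) * (x n ^ ℓ)⁻¹) :
              Fin T → Fin M → Fin k → F) t u i = _
          rw [Pi.single_eq_same, Pi.single_eq_same]
        change (permutedIndex (key K).1 (e'.2 t u).1 i, masked (x n) (increment (e'.2 t u)
            ((key K).1 (permutedIndex (key K).1 (e'.2 t u).1 i))) (noise K z t u i)) =
          (permutedIndex K.1 (e.2 t u).1 i, masked (x n) (increment (e.2 t u)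
            (K.1 (permutedIndex K.1 (e.2 t u).1 i))) (z t u i))
        rw [hz, masked_add hx, hindex]

lemma revealsOnly_upload
    (hstat : ∀ X X', stat X = stat X' ↔ ∃ π ∈ 𝒜.perms, X'.1 = X.1.map π.toEmbedding)
    (n : Fin N) (hx : x n ≠ 0) (t : Fin T) (u : Fin M) :
    RevealsOnly (R := (𝒜.scheme x k k' M).Key × (𝒜.scheme x k k' M).Noise ×
        (Fin T → Fin M → (𝒜.scheme x k k' M).UserNoise))
      ((𝒜.scheme x k k' M).uploadAt (T := T) t u n)
      (fun e : Env F P ℓ k M T => stat (e.2 t u).1) :=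
  (𝒜.revealsOnly_content_upload k' M hstat n hx t u).comp Prod.snd
    fun e r e' r' h => 𝒜.stat_eq_of_upload_eq k' M hstat n t u (e, r) (e', r') h

lemma privateValues {x : Fin N → F} (hx : ∀ n, x n ≠ 0)
    (hstat : ∀ X X', stat X = stat X' ↔ ∃ π ∈ 𝒜.perms, X'.1 = X.1.map π.toEmbedding) :
    (𝒜.scheme x k k' M).PrivateValues stat := by
  intro T D hD t u n
  refine ⟨?_, fun i hi => ?_⟩
  · exact (𝒜.revealsOnly_content_upload k' M hstat n (hx n) t u).condMutualInfo_eq_zero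
      (D := D) (c := (𝒜.scheme x k k' M).uniformWeight T) (fun ω => Scheme.weight_eq _ ω)
      (Scheme.weight_nonneg _ hD) (fun e => (e.2 t u).1) stat (fun _ => rfl)
      (fun e => (e.2 t u).2)
  · exact (𝒜.revealsOnly_upload k' M hstat n (hx n) t u).mutualInfo_eq_zero
      (D := D) (c := (𝒜.scheme x k k' M).uniformWeight T) (fun ω => Scheme.weight_eq _ ω)
      (Scheme.weight_nonneg _ hD) (Scheme.sum_weight _ hD) (fun e => (e.2 t u).2 i) hi

lemma indexLeakage {x : Fin N → F} (hx : ∀ n, x n ≠ 0)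
    (hstat : ∀ X X', stat X = stat X' ↔ ∃ π ∈ 𝒜.perms, X'.1 = X.1.map π.toEmbedding) :
    (𝒜.scheme x k k' M).IndexLeakage stat := by
  intro T D hD t u n
  constructor
  · exact (𝒜.revealsOnly_upload k' M hstat n (hx n) t u).mutualInfo_eq
      (D := D) (c := (𝒜.scheme x k k' M).uniformWeight T) (fun ω => Scheme.weight_eq _ ω)
      (Scheme.weight_nonneg _ hD) (fun e => (e.2 t u).1) stat (fun _ => rfl)
  · exact (𝒜.revealsOnly_content_upload k' M hstat n (hx n) t u).mutualInfo_eq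
      (D := D) (c := (𝒜.scheme x k k' M).uniformWeight T) (fun ω => Scheme.weight_eq _ ω)
      (Scheme.weight_nonneg _ hD) (fun e => (e.2 t u).1) stat (fun _ => rfl)

end Addressing

/-! ### Costs -/

lemma symbols_pi {F : Type} [Fintype F] {A κ : Type} [Fintype A] [Fintype κ] [Fintype (κ → A)] :
    Scheme.symbols F (κ → A) = Fintype.card κ * Scheme.symbols F A := by
  have : Fintype.card (κ → A) = Fintype.card A ^ Fintype.card κ := by
    simp only [← Nat.card_eq_fintype_card, Nat.card_fun]
  rw [Scheme.symbols, this, Nat.cast_pow, Real.logb_pow, Scheme.symbols]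

lemma symbols_prod {F : Type} [Fintype F] {A A' : Type} [Fintype A] [Fintype A'] [Nonempty A]
    [Nonempty A'] :
    Scheme.symbols F (A × A') = Scheme.symbols F A + Scheme.symbols F A' := by
  rw [Scheme.symbols, Fintype.card_prod, Nat.cast_mul, Real.logb_mul (by simp) (by simp)]
  rfl

lemma symbols_self {F : Type} [Field F] [Fintype F] : Scheme.symbols F F = 1 :=
  Real.logb_self_eq_one (by exact_mod_cast Fintype.one_lt_card)

namespace Addressing

variable {F : Type} [Field F] [Fintype F] {N P ℓ d : ℕ} (𝒜 : Addressing F P ℓ d)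
  (x : Fin N → F) (k k' M : ℕ)

lemma readingCost_eq {c : ℕ} (hℓ : 0 < ℓ) (hN : N = c * ℓ + 1) (hc : 0 < c) (hP : 0 < P)
    {r : ℝ} (hr : (P : ℝ) * r = k') :
    (𝒜.scheme x k k' M).readingCost =
      c * r * (1 + Real.logb (Fintype.card F) P / N) / (1 - 1 / (N : ℝ)) := by
  have h1 : Scheme.symbols F (𝒜.scheme x k k' M).Announcement =
      k' * Real.logb (Fintype.card F) P := by
    refine (symbols_pi (A := Fin P) (κ := Fin k')).trans ?_
    simp [Scheme.symbols]
  have h2 : ∀ n, Scheme.symbols F ((𝒜.scheme x k k' M).Answer n) = k' := by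
    intro n
    refine (symbols_pi (A := F) (κ := Fin k')).trans ?_
    simp [symbols_self]
  rw [Scheme.readingCost, h1, Finset.sum_congr rfl fun n _ => h2 n, ← hr]
  have hℓ' : (ℓ : ℝ) ≠ 0 := by positivity
  have hP' : (P : ℝ) ≠ 0 := by positivity
  have hc' : (c : ℝ) ≠ 0 := by positivity
  have hN' : (N : ℝ) = c * ℓ + 1 := by exact_mod_cast hN
  have hN0 : (N : ℝ) ≠ 0 := by rw [hN']; positivity
  have e : (1 : ℝ) - 1 / N = c * ℓ / N := by rw [hN'] at hN0 ⊢; field_simp; ring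
  rw [e]
  simp only [Finset.sum_const, Finset.card_univ, Fintype.card_fin, nsmul_eq_mul]
  field_simp
  ring

lemma writingCost_eq {c : ℕ} (hℓ : 0 < ℓ) (hN : N = c * ℓ + 1) (hc : 0 < c) (hP : 0 < P)
    {r : ℝ} (hr : (P : ℝ) * r = k) :
    (𝒜.scheme x k k' M).writingCost =
      c * r * (1 + Real.logb (Fintype.card F) P) / (1 - 1 / (N : ℝ)) := by
  have h1 : ∀ n, Scheme.symbols F ((𝒜.scheme x k k' M).Upload n) =
      k * (Real.logb (Fintype.card F) P + 1) := by
    intro n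
    have : Nonempty (Fin P) := ⟨⟨0, hP⟩⟩
    refine (symbols_pi (A := Fin P × F) (κ := Fin k)).trans ?_
    rw [symbols_prod, symbols_self]
    simp [Scheme.symbols]
  rw [Scheme.writingCost, Finset.sum_congr rfl fun n _ => h1 n, ← hr]
  have hℓ' : (ℓ : ℝ) ≠ 0 := by positivity
  have hP' : (P : ℝ) ≠ 0 := by positivity
  have hc' : (c : ℝ) ≠ 0 := by positivity
  have hN' : (N : ℝ) = c * ℓ + 1 := by exact_mod_cast hN
  have hN0 : (N : ℝ) ≠ 0 := by rw [hN']; positivity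
  have e : (1 : ℝ) - 1 / N = c * ℓ / N := by rw [hN'] at hN0 ⊢; field_simp; ring
  rw [e]
  simp only [Finset.sum_const, Finset.card_univ, Fintype.card_fin, nsmul_eq_mul]
  field_simp
  ring

lemma storage_eq (n : Fin N) :
    (𝒜.scheme x k k' M).storage n = P + Fintype.card 𝒜.Entry := by
  classical
  refine (symbols_prod (A := Fin P → F) (A' := 𝒜.Entry → F)).trans ?_
  rw [symbols_pi, symbols_pi, symbols_self]
  simp

end Addressing

/-! ### The two addressings -/

section Addressings

variable (F : Type) [Field F] {P B : ℕ} (ℓ : ℕ) (hBP : B ∣ P)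

/-- Permutations within the segments: a permuted index is stored by the position, within its
segment, of the real index. -/
noncomputable def withinSegments : Addressing F P ℓ 1 where
  perms := segmentPerms hBP ⊥
  Entry := Fin (P / B) × Fin P
  mark π i := if offset hBP (π i.2) = i.1 then 1 else 0
  access a s p := if seg hBP s = seg hBP p then a (offset hBP s, p) else 0
  access_spec := by
    rintro π ⟨σ, hσ, h⟩ z s p
    rw [Subgroup.mem_bot] at hσ
    subst hσ
    by_cases hs : seg hBP s = seg hBP p
    · have hiff : offset hBP (π p) = offset hBP s ↔ π p = s :=
        ⟨eq_of_seg_eq_of_offset_eq hBP ((h p).trans hs.symm), fun h => by rw [h]⟩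
      refine ⟨C (if π p = s then 1 else 0) + C (z (offset hBP s, p)) * X ^ ℓ, ?_, ?_, ?_⟩
      · rw [one_mul]
        exact natDegree_add_le_of_degree_le ((natDegree_C _).trans_le ℓ.zero_le) (natDegree_C_mul_X_pow_le _ _)
      · rw [add_sub_cancel_left]
        exact dvd_mul_left _ _
      · intro x
        simp only [if_pos hs, hiff, eval_add, eval_mul, eval_C, eval_pow, eval_X]
    · have hne : π p ≠ s := by
        rintro rfl
        exact hs (h p)
      exact ⟨0, by simp, by simp [hne], by simp [hs]⟩

/-- Permutations within and of the segments: besides the position within its segment of the real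
index of each permuted index, the permutation of the segments is stored as a matrix. -/
noncomputable def acrossSegments : Addressing F P ℓ 2 where
  perms := segmentPerms hBP ⊤
  Entry := (Fin (P / B) × Fin P) ⊕ (Fin B × Fin B)
  mark π i := by
    classical
    exact i.elim (fun i => if offset hBP (π i.2) = i.1 then 1 else 0)
      (fun b => if ∃ p, seg hBP p = b.2 ∧ seg hBP (π p) = b.1 then 1 else 0)
  access a s p := a (.inl (offset hBP s, p)) * a (.inr (seg hBP s, seg hBP p))
  access_spec := by
    classical
    rintro π ⟨σ, -, h⟩ z s p
    have h1 : (∃ p', seg hBP p' = seg hBP p ∧ seg hBP (π p') = seg hBP s) ↔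
        seg hBP (π p) = seg hBP s :=
      ⟨by rintro ⟨p', h1, h2⟩; rw [h, ← h1, ← h, h2], fun h => ⟨p, rfl, h⟩⟩
    have h2 : π p = s ↔ offset hBP (π p) = offset hBP s ∧ seg hBP (π p) = seg hBP s :=
      ⟨by rintro rfl; exact ⟨rfl, rfl⟩, fun h => eq_of_seg_eq_of_offset_eq hBP h.2 h.1⟩
    refine ⟨(C (if offset hBP (π p) = offset hBP s then 1 else 0) +
        C (z (.inl (offset hBP s, p))) * X ^ ℓ) *
      (C (if seg hBP (π p) = seg hBP s then 1 else 0) +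
        C (z (.inr (seg hBP s, seg hBP p))) * X ^ ℓ), ?_, ?_, ?_⟩
    · rw [two_mul]
      refine natDegree_mul_le_of_le ?_ ?_ <;>
      exact natDegree_add_le_of_degree_le ((natDegree_C _).trans_le ℓ.zero_le) (natDegree_C_mul_X_pow_le _ _)
    · have e : (if π p = s then (1 : F) else 0) =
          (if offset hBP (π p) = offset hBP s then 1 else 0) *
          (if seg hBP (π p) = seg hBP s then 1 else 0) := by
        rw [if_congr h2 rfl rfl, ite_and]
        split_ifs <;> simp
      rw [e, C_mul]
      generalize C (if offset hBP (π p) = offset hBP s then (1 : F) else 0) = u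
      generalize C (if seg hBP (π p) = seg hBP s then (1 : F) else 0) = v
      generalize C (z (.inl (offset hBP s, p))) = y
      generalize C (z (.inr (seg hBP s, seg hBP p))) = y'
      exact ⟨y * v + u * y' + y * y' * X ^ ℓ, by ring⟩
    · intro x
      simp only [Sum.elim_inl, Sum.elim_inr, h1, eval_add, eval_mul, eval_C, eval_pow, eval_X]

lemma card_entry_withinSegments :
    (Fintype.card (withinSegments F ℓ hBP).Entry : ℝ) = (P : ℝ) ^ 2 / B := by
  have : Fintype.card (withinSegments F ℓ hBP).Entry = P / B * P :=
    (Fintype.card_prod (Fin (P / B)) (Fin P)).trans (by simp)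
  rw [this, Nat.cast_mul, Nat.cast_div_charZero hBP]
  ring

lemma card_entry_acrossSegments :
    (Fintype.card (acrossSegments F ℓ hBP).Entry : ℝ) = (P : ℝ) ^ 2 / B + (B : ℝ) ^ 2 := by
  have : Fintype.card (acrossSegments F ℓ hBP).Entry = P / B * P + B * B :=
    (Fintype.card_sum (α := Fin (P / B) × Fin P) (β := Fin B × Fin B)).trans (by simp)
  rw [this, Nat.cast_add, Nat.cast_mul, Nat.cast_mul, Nat.cast_div_charZero hBP]
  ring

end Addressings

/-- A field with more than `N` elements has `N` distinct nonzero ones. -/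
lemma exists_points {F : Type} [Field F] [Fintype F] {N : ℕ} (h : N < Fintype.card F) :
    ∃ x : Fin N → F, Function.Injective x ∧ ∀ n, x n ≠ 0 := by
  classical
  have : Fintype.card (Fin N) ≤ Fintype.card Fˣ := by
    rw [Fintype.card_units, Fintype.card_fin]
    omega
  obtain ⟨f⟩ := Function.Embedding.nonempty_of_card_le this
  exact ⟨fun n => f n, Units.val_injective.comp f.injective, fun n => (f n).ne_zero⟩

/-- `P` and `P ^ 2 / B` are both of the order of `L ^ 2 / (B N ^ 2)`. -/
lemma le_storage_bound {N P B ℓ L c : ℕ} (hℓ : 0 < ℓ) (hN : N = c * ℓ + 1) (hP : 0 < P)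
    (hBP : B ∣ P) (hL : L = P * ℓ) :
    (P : ℝ) ≤ (P : ℝ) ^ 2 / B ∧
      (P : ℝ) ^ 2 / B ≤ (c + 1) ^ 2 * ((L : ℝ) ^ 2 / (B * (N : ℝ) ^ 2)) := by
  have hB : 0 < B := Nat.pos_of_dvd_of_pos hBP hP
  have hB' : (0 : ℝ) < B := by exact_mod_cast hB
  have hP' : (0 : ℝ) < P := by exact_mod_cast hP
  have hℓ' : (1 : ℝ) ≤ ℓ := by exact_mod_cast hℓ
  have hN' : (N : ℝ) = c * ℓ + 1 := by exact_mod_cast hN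
  have hN0 : (0 : ℝ) < N := by rw [hN']; positivity
  have hNle : (N : ℝ) ≤ (c + 1) * ℓ := by rw [hN']; linarith
  constructor
  · rw [le_div_iff₀ hB', sq]
    exact mul_le_mul_of_nonneg_left (by exact_mod_cast Nat.le_of_dvd hP hBP) hP'.le
  · have e : ((c : ℝ) + 1) ^ 2 * ((L : ℝ) ^ 2 / (B * (N : ℝ) ^ 2)) =
        (P : ℝ) ^ 2 / B * (((c + 1) * ℓ) / N) ^ 2 := by
      rw [hL]
      push_cast
      field_simp
    rw [e]
    refine le_mul_of_one_le_right (by positivity) (one_le_pow₀ ?_)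
    rwa [one_le_div hN0]

end PRUW

theorem theorem1 :
    -- Case 1: within-segment permutations
    (∃ C : ℝ, ∀ (F : Type) [Field F] [Fintype F] (N ℓ P B L M k k' : ℕ) (r r' : ℝ),
      0 < ℓ → N = 3 * ℓ + 1 → N < Fintype.card F → 0 < P → B ∣ P → L = P * ℓ →
      0 ≤ r → r ≤ 1 → (P : ℝ) * r = k → 0 ≤ r' → r' ≤ 1 → (P : ℝ) * r' = k' →
      ∃ 𝒮 : PRUW.Scheme F N P ℓ k k' M,
        (∀ (K : 𝒮.Key) (s : Fin P),
          PRUW.segment P B (𝒮.perm K s) = PRUW.segment P B s) ∧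
        𝒮.StoresModel ∧ 𝒮.UploadsIndices ∧ 𝒮.ReadsCorrectly ∧ 𝒮.Secure ∧
        𝒮.PrivateValues (PRUW.segmentCounts B) ∧
        𝒮.IndexLeakage (PRUW.segmentCounts B) ∧
        𝒮.readingCost =
          3 * r' * (1 + Real.logb (Fintype.card F) P / N) / (1 - 1 / (N : ℝ)) ∧
        𝒮.writingCost =
          3 * r * (1 + Real.logb (Fintype.card F) P) / (1 - 1 / (N : ℝ)) ∧
        ∀ n, 𝒮.storage n ≤ C * ((L : ℝ) ^ 2 / (B * (N : ℝ) ^ 2))) ∧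
    -- Case 2: within-segment and inter-segment permutations
    (∃ C : ℝ, ∀ (F : Type) [Field F] [Fintype F] (N ℓ P B L M k k' : ℕ) (r r' : ℝ),
      0 < ℓ → N = 5 * ℓ + 1 → N < Fintype.card F → 0 < P → B ∣ P → L = P * ℓ →
      0 ≤ r → r ≤ 1 → (P : ℝ) * r = k → 0 ≤ r' → r' ≤ 1 → (P : ℝ) * r' = k' →
      ∃ 𝒮 : PRUW.Scheme F N P ℓ k k' M,
        (∀ (K : 𝒮.Key) (s s' : Fin P), PRUW.segment P B s = PRUW.segment P B s' →
          PRUW.segment P B (𝒮.perm K s) = PRUW.segment P B (𝒮.perm K s')) ∧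
        𝒮.StoresModel ∧ 𝒮.UploadsIndices ∧ 𝒮.ReadsCorrectly ∧ 𝒮.Secure ∧
        𝒮.PrivateValues (PRUW.unorderedCounts B) ∧
        𝒮.IndexLeakage (PRUW.unorderedCounts B) ∧
        𝒮.readingCost =
          5 * r' * (1 + Real.logb (Fintype.card F) P / N) / (1 - 1 / (N : ℝ)) ∧
        𝒮.writingCost =
          5 * r * (1 + Real.logb (Fintype.card F) P) / (1 - 1 / (N : ℝ)) ∧
        ∀ n, 𝒮.storage n ≤ C * max ((L : ℝ) ^ 2 / (B * (N : ℝ) ^ 2)) ((B : ℝ) ^ 2)) := by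
  constructor
  · -- `P ^ 2 / B ≤ (3 + 1) ^ 2 * (L ^ 2 / (B * N ^ 2))`, needed twice
    refine ⟨32, ?_⟩
    intro F _ _ N ℓ P B L M k k' r r' hℓ hN hF hP hBP hL _ _ hr _ _ hr'
    obtain ⟨x, hx, hx0⟩ := PRUW.exists_points hF
    have hstat := PRUW.segmentCounts_eq_iff (k := k) hBP
    refine ⟨(PRUW.withinSegments F ℓ hBP).scheme x k k' M, ?_,
      PRUW.Addressing.storesModel _ k k' M hx (by omega),
      PRUW.Addressing.uploadsIndices _ x k k' M,
      PRUW.Addressing.readsCorrectly _ k k' M hx (by omega),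
      PRUW.Addressing.secure _ k k' M hx0, PRUW.Addressing.privateValues _ k' M hx0 hstat,
      PRUW.Addressing.indexLeakage _ k' M hx0 hstat, ?_, ?_, fun n => ?_⟩
    · rintro ⟨π, σ, hσ, h⟩ s
      rw [Subgroup.mem_bot] at hσ
      subst hσ
      exact congrArg Fin.val (h s)
    · exact_mod_cast PRUW.Addressing.readingCost_eq _ x k k' M hℓ hN (by norm_num) hP hr'
    · exact_mod_cast PRUW.Addressing.writingCost_eq _ x k k' M hℓ hN (by norm_num) hP hr
    · rw [PRUW.Addressing.storage_eq, PRUW.card_entry_withinSegments]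
      obtain ⟨h1, h2⟩ := PRUW.le_storage_bound hℓ hN hP hBP hL
      norm_num at h2
      linarith
  · -- `P ^ 2 / B ≤ (5 + 1) ^ 2 * (L ^ 2 / (B * N ^ 2))`, needed twice, besides `B ^ 2`
    refine ⟨73, ?_⟩
    intro F _ _ N ℓ P B L M k k' r r' hℓ hN hF hP hBP hL _ _ hr _ _ hr'
    obtain ⟨x, hx, hx0⟩ := PRUW.exists_points hF
    have hstat := PRUW.unorderedCounts_eq_iff (k := k) hBP
    refine ⟨(PRUW.acrossSegments F ℓ hBP).scheme x k k' M, ?_,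
      PRUW.Addressing.storesModel _ k k' M hx (by omega),
      PRUW.Addressing.uploadsIndices _ x k k' M,
      PRUW.Addressing.readsCorrectly _ k k' M hx (by omega),
      PRUW.Addressing.secure _ k k' M hx0, PRUW.Addressing.privateValues _ k' M hx0 hstat,
      PRUW.Addressing.indexLeakage _ k' M hx0 hstat, ?_, ?_, fun n => ?_⟩
    · rintro ⟨π, σ, -, h⟩ s s' hs
      have hs' : PRUW.seg hBP s = PRUW.seg hBP s' := Fin.ext hs
      exact congrArg Fin.val ((h s).trans ((congrArg σ hs').trans (h s').symm))
    · exact_mod_cast PRUW.Addressing.readingCost_eq _ x k k' M hℓ hN (by norm_num) hP hr'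
    · exact_mod_cast PRUW.Addressing.writingCost_eq _ x k k' M hℓ hN (by norm_num) hP hr
    · rw [PRUW.Addressing.storage_eq, PRUW.card_entry_acrossSegments]
      obtain ⟨h1, h2⟩ := PRUW.le_storage_bound hℓ hN hP hBP hL
      norm_num at h2
      have h3 := le_max_left ((L : ℝ) ^ 2 / (B * (N : ℝ) ^ 2)) ((B : ℝ) ^ 2)
      have h4 := le_max_right ((L : ℝ) ^ 2 / (B * (N : ℝ) ^ 2)) ((B : ℝ) ^ 2)
      linarith
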